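/- Let $H=\bigoplus_{n\ge 0}H_n$ be a commutative connected graded Hopf algebra over $\mathbb{C}$ (for instance the Hopf algebra of 1PI Feynman graphs, graded by loop number), let $Y$ be its grading operator ($Y=n$ on $H_n$), and let $\varepsilon$ be its counit. For a commutative $\mathbb C$-algebra $A$ let $G(A)=\mathrm{Hom}_{\rm alg}(H,A)$, a group under the convolution product $\star$, with Lie algebra $\mathfrak g(A)$ of infinitesimal characters. Let $\mathcal A=\mathbb{C}\{\{z\}\}$ be the algebra of Laurent series in $z$ with poles of finite order, and $\mathcal A_+$ its subalgebra of series without pole; the series may be read throughout as formal ones or throughout as convergent ones, and the statement holds in both readings. Write $t=e^{s}$, $s\in\mathbb{C}$, for the mass scale and $t^z=e^{sz}$ (so $t$ lives on the universal cover of $\mathbb{C}^\times$). For $\gamma\in G(\mathcal A)$ put $\gamma_{t^z}=t^{zY}\gamma$, that is $\gamma_{t^z}(x)=e^{nsz}\gamma(x)$ for $x\in H_n$. Sections over $\Delta^*\times\{t\}$ are characters of $H$ whose values are Laurent series in $z$ with finite pole order and coefficients entire in $s$. Every $g\in G(\mathcal A)$, and every section $g$, has a unique Birkhoff decomposition $g=g_-^{\star-1}\star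 g_+$, where $g_+$ has no pole at $z=0$ and $g_-$ takes values in series with only negative powers of $z$ on $\ker\varepsilon$; $g_-$ is called the counterterm of $g$. Put $\tilde R(g)=g^{\star-1}\star Y(g)$ with $Y(g)=g\circ Y$, and $Dg=g^{\star-1}\star dg=g^{\star-1}\star\partial_zg\,dz+g^{\star-1}\star t\partial_tg\,\frac{dt}{t}$. Put $$\beta(g)=\frac{d}{dt}\Big|_{t=1}\lim_{z\to0}g^{\star-1}\star t^{zY}(g)$$ for $g\in G(\mathcal A)$ whenever the limit exists. Say that $\gamma\in G(\mathcal A)$ is local if the counterterm $(\gamma_{t^z})_-$ is independent of the mass scale: $\frac{d}{dt}(\gamma_{t^z})_-=0$. Call two one-forms $\eta,\eta'$ equivalent, $\eta\sim\eta'$, if $\eta'=D\psi+\psi^{\star-1}\star\eta\star\psi$ for some section $\psi$ that is regular in $z$ and $t$ (the gauge group $G(\mathcal A_+)_t$). **Theorem.** Let $\omega$ be a connection on the trivial $G$-bundle $P^*\to B^*$, that is, an assignment $f\mapsto f^*\omega$ of one-forms to sections with $(f\star\psi)^*\omega=D\psi+\psi^{\star-1}\star f^*\omega\star\psi$ for all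 sections $f,\psi$, such that $\gamma_{t^z}^*\omega=D\gamma_{t^z}$ for all $\gamma\in G(\mathcal A)$. 1. If $\gamma$ is local, with Birkhoff decomposition $\gamma=\gamma_-^{\star-1}\star\gamma_+$, then the limits defining $\beta(\gamma_-^{\star-1})$ and $\beta(\gamma)$ exist, $\beta(\gamma_-^{\star-1})\in\mathfrak g(\mathbb{C})$, and $\beta(\gamma)=\gamma_+(0)^{\star-1}\star\beta(\gamma_-^{\star-1})\star\gamma_+(0)$. The element $\beta(\gamma_-^{\star-1})$ is the $\beta$-function of the Lagrangian represented by $\gamma$. 2. The equivalence class of $\gamma_{t^z}^*\omega$, for local $\gamma$, is determined by $\tilde R((\gamma_{t^z})_-)$: if $\gamma,\gamma'$ are local and $\tilde R((\gamma_{t^z})_-)=\tilde R((\gamma'_{t^z})_-)$, then $\gamma_{t^z}^*\omega\sim\gamma_{t^z}'^*\omega$. 3. It is determined by the $\beta$-function: if $\gamma,\gamma'$ are local and $\beta(\gamma_-^{\star-1})=\beta(\gamma_-'^{\star-1})$, then $\gamma_{t^z}^*\omega\sim\gamma_{t^z}'^*\omega$. 4. For local $\gamma,\gamma'$ the following are equivalent: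 $\tilde R((\gamma_{t^z})_-)=\tilde R((\gamma'_{t^z})_-)$; $\beta(\gamma_-^{\star-1})=\beta(\gamma_-'^{\star-1})$; there is a section $\psi$, regular in $z$ and $t$, with $\gamma'_{t^z}=\gamma_{t^z}\star\psi$. -/

import Mathlib

namespace Renormalization

open WithConv TensorProduct

noncomputable section

/-- The group `G(K) = Hom_alg(H, K)` of `K`-valued characters of the Hopf algebra `H`; the product is
the convolution product. -/
abbrev CharGroup (H K : Type*) [CommRing H] [HopfAlgebra ℂ H] [CommRing K] [Algebra ℂ K] :=
  WithConv (H →ₐ[ℂ] K)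

/-- Linear maps `H → K` with the convolution product. It contains `G(K)` and the Lie algebra `𝔤(K)`. -/
abbrev LinForm (H K : Type*) [CommRing H] [HopfAlgebra ℂ H] [CommRing K] [Algebra ℂ K] :=
  WithConv (H →ₗ[ℂ] K)

/-- A character viewed in the convolution algebra. -/
def CharGroup.toLin {H K : Type*} [CommRing H] [HopfAlgebra ℂ H] [CommRing K] [Algebra ℂ K]
    (g : CharGroup H K) : LinForm H K := toConv g.ofConv.toLinearMap

/-- Entire functions of one complex variable `s`. The mass scale is `t = exp s`. -/
def EntireFun : Subalgebra ℂ (ℂ → ℂ) where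
  carrier := {f | Differentiable ℂ f}
  mul_mem' hf hg := Differentiable.mul hf hg
  add_mem' hf hg := Differentiable.add hf hg
  algebraMap_mem' c := differentiable_const c

/-- The derivative `d/ds = t d/dt` of an entire function. -/
def EntireFun.deriv : EntireFun →ₗ[ℂ] EntireFun where
  toFun f := ⟨_root_.deriv f.1, by
    have h : Differentiable ℂ f.1 := f.2
    have := h.contDiff (n := 2)
    exact (this.iterate_deriv' 1 1).differentiable (by norm_num)⟩
  map_add' f g := by
    ext s
    exact deriv_add (f.2 s) (g.2 s)
  map_smul' c f := by
    ext s
    exact deriv_const_smul c (f.2 s)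

/-- The coefficientwise `ℂ`-algebra structure, put in front of another (propositionally equal) one. -/
instance laurentAlgebra (R : Type*) [CommRing R] [Algebra ℂ R] : Algebra ℂ (LaurentSeries R) :=
  HahnSeries.instAlgebra

/-- The algebra `𝒜` of Laurent series in `z` with finite pole order. -/
abbrev LaurentA := LaurentSeries ℂ
/-- Laurent series in `z` with finite pole order whose coefficients are entire functions of
`s = log t`: functions on `Δ* × {t}`, with `t` on the universal cover of `ℂˣ`. -/
abbrev LaurentF := LaurentSeries EntireFun

/-- A Laurent series, viewed as a family that does not depend on `s`. -/
def constFamily : LaurentA →ₐ[ℂ] LaurentF where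
  toFun f := f.map (algebraMap ℂ EntireFun)
  map_one' := HahnSeries.map_one (algebraMap ℂ EntireFun).toMonoidWithZeroHom
  map_mul' f g := HahnSeries.map_mul ((algebraMap ℂ EntireFun : ℂ →+* EntireFun) : ℂ →ₙ+* EntireFun)
  map_zero' := by ext n; simp
  map_add' f g := by ext n; simp
  commutes' c := by
    rw [HahnSeries.algebraMap_apply, HahnSeries.algebraMap_apply]
    exact HahnSeries.map_C _ (algebraMap ℂ EntireFun : ℂ →+* EntireFun)


/-- The grading `H = ⨁ 𝒢 n` is a connected grading of Hopf algebras.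
(That it is an algebra grading is `GradedAlgebra 𝒢`.) -/
structure IsConnectedGradedHopf {H : Type*} [CommRing H] [HopfAlgebra ℂ H]
    (𝒢 : ℕ → Submodule ℂ H) : Prop where
  zero_eq : 𝒢 0 = Submodule.span ℂ {1}
  counit_eq_zero : ∀ n, n ≠ 0 → ∀ x ∈ 𝒢 n, Coalgebra.counit (R := ℂ) x = 0
  comul_mem : ∀ n, ∀ x ∈ 𝒢 n, Coalgebra.comul (R := ℂ) x ∈
    ⨆ p ∈ Finset.HasAntidiagonal.antidiagonal n,
      LinearMap.range (TensorProduct.map (𝒢 p.1).subtype (𝒢 p.2).subtype)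

variable {H : Type*} [CommRing H] [HopfAlgebra ℂ H] {K : Type*} [CommRing K] [Algebra ℂ K]

/-- Inverse of a character: composition with the antipode. -/
instance charInv : Inv (CharGroup H K) where
  inv f := toConv (f.ofConv.comp (HopfAlgebra.antipodeAlgHom ℂ H))

instance charGroup : Group (CharGroup H K) where
  inv_mul_cancel f := by
    apply WithConv.ext
    apply AlgHom.ext
    intro x
    let r := Coalgebra.Repr.arbitrary ℂ x
    change ((f⁻¹).toLin * f.toLin) x = algebraMap ℂ K (Coalgebra.counit x)
    rw [r.convMul_apply]
    change ∑ i ∈ r.index, f.ofConv (HopfAlgebra.antipode ℂ (r.left i)) * f.ofConv (r.right i) = _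
    simp_rw [← map_mul]
    rw [← map_sum, HopfAlgebra.sum_antipode_mul_eq_algebraMap_counit, AlgHom.commutes]

/-- The character `u^Y φ`, equal to `u ^ n * φ x` for `x` of degree `n`. -/
def scale (𝒢 : ℕ → Submodule ℂ H) [GradedAlgebra 𝒢] (u : K) (φ : CharGroup H K) : CharGroup H K :=
  toConv <| (DirectSum.toAlgebra ℂ (fun n => 𝒢 n)
    (fun n => (LinearMap.mulLeft ℂ (u ^ n)) ∘ₗ φ.ofConv.toLinearMap ∘ₗ (𝒢 n).subtype)
    (by simp) (by intro i j x y; simp [pow_add]; ring)).comp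
    (DirectSum.decomposeAlgEquiv 𝒢).toAlgHom

theorem scale_apply (𝒢 : ℕ → Submodule ℂ H) [GradedAlgebra 𝒢] (u : K) (φ : CharGroup H K)
   (n : ℕ) (x : H) (hx : x ∈ 𝒢 n) : scale 𝒢 u φ x = u ^ n * φ x := by
  simp [scale, DirectSum.toAlgebra_apply, DirectSum.decompose_of_mem 𝒢 hx]
  erw [DirectSum.toSemiring_of]
  simp

/-- The grading operator `Y`, with `Y x = n x` for `x` of degree `n`. -/
def degreeOp (𝒢 : ℕ → Submodule ℂ H) [GradedAlgebra 𝒢] : H →ₗ[ℂ] H :=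
  DirectSum.toModule ℂ ℕ H (fun n => (n : ℂ) • (𝒢 n).subtype) ∘ₗ
    (DirectSum.decomposeLinearEquiv 𝒢).toLinearMap

theorem degreeOp_apply (𝒢 : ℕ → Submodule ℂ H) [GradedAlgebra 𝒢] 
   (n : ℕ) (x : H) (hx : x ∈ 𝒢 n) : degreeOp 𝒢 x = (n : ℂ) • x := by
  rw [degreeOp, LinearMap.comp_apply, LinearEquiv.coe_coe, DirectSum.decomposeLinearEquiv_apply,
    DirectSum.decompose_of_mem 𝒢 hx]
  exact DirectSum.toModule_lof ℂ n _


section Birkhoff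
set_option linter.unusedSectionVars false
variable {R : Type*} [CommRing R] [Algebra ℂ R]

/-- No pole at `z = 0`. -/
def IsRegular (f : LaurentSeries R) : Prop := ∀ n < 0, f.coeff n = 0
/-- Only negative powers of `z`. -/
def IsPolar (f : LaurentSeries R) : Prop := ∀ n, 0 ≤ n → f.coeff n = 0

/-- The part of a Laurent series with negative powers of `z`. -/
def polarPart : LaurentSeries R →ₗ[ℂ] LaurentSeries R := HahnSeries.truncLTLinearMap ℂ 0

theorem isPolar_polarPart (f : LaurentSeries R) : IsPolar (polarPart f) := fun n hn => by
  simp [polarPart, HahnSeries.coeff_truncLT_of_le hn]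

theorem isRegular_sub_polarPart (f : LaurentSeries R) : IsRegular (f - polarPart f) := fun n hn => by
  simp [polarPart, HahnSeries.coeff_truncLT_of_lt hn]

theorem IsRegular.mul {f g : LaurentSeries R} (hf : IsRegular f) (hg : IsRegular g) :
    IsRegular (f * g) := fun n hn => by
  rw [HahnSeries.coeff_mul]
  refine Finset.sum_eq_zero fun ij hij => ?_
  have h := (Finset.mem_antidiagonal.1 hij).2.2
  rcases lt_or_ge ij.1 0 with h1 | h1
  · rw [hf _ h1, zero_mul]
  · rw [hg _ (by omega), mul_zero]

theorem IsPolar.mul {f g : LaurentSeries R} (hf : IsPolar f) (hg : IsPolar g) :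
    IsPolar (f * g) := fun n hn => by
  rw [HahnSeries.coeff_mul]
  refine Finset.sum_eq_zero fun ij hij => ?_
  have h := (Finset.mem_antidiagonal.1 hij).2.2
  rcases le_or_gt 0 ij.1 with h1 | h1
  · rw [hf _ h1, zero_mul]
  · rw [hg _ (by omega), mul_zero]

theorem IsRegular.sub {f g : LaurentSeries R} (hf : IsRegular f) (hg : IsRegular g) :
    IsRegular (f - g) := fun n hn => by simp [hf n hn, hg n hn]

theorem IsPolar.sub {f g : LaurentSeries R} (hf : IsPolar f) (hg : IsPolar g) :
    IsPolar (f - g) := fun n hn => by simp [hf n hn, hg n hn]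

theorem eq_zero_of_isRegular_of_isPolar {f : LaurentSeries R} (hf : IsRegular f) (hg : IsPolar f) :
    f = 0 := by
  ext n
  rcases lt_or_ge n 0 with h | h
  · exact hf n h
  · exact hg n h

theorem isRegular_smul_one (c : ℂ) : IsRegular (algebraMap ℂ (LaurentSeries R) c) := fun n hn => by
  rw [HahnSeries.algebraMap_apply, HahnSeries.C_apply, HahnSeries.coeff_single_of_ne hn.ne]

variable {𝒢 : ℕ → Submodule ℂ H}

theorem IsConnectedGradedHopf.conv_eq_zero (h𝒢 : IsConnectedGradedHopf 𝒢) {n : ℕ}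
    {d a : LinForm H K} (hd : ∀ i < n, ∀ x ∈ 𝒢 i, d x = 0) (ha : ∀ x ∈ 𝒢 0, a x = 0)
    {x : H} (hx : x ∈ 𝒢 n) : (d * a) x = 0 := by
  have key : (⨆ p ∈ Finset.HasAntidiagonal.antidiagonal n,
      LinearMap.range (TensorProduct.map (𝒢 p.1).subtype (𝒢 p.2).subtype)) ≤
      LinearMap.ker (LinearMap.mul' ℂ K ∘ₗ TensorProduct.map d.ofConv a.ofConv) := by
    refine iSup₂_le fun p hp => ?_
    rintro _ ⟨t, rfl⟩
    rw [LinearMap.mem_ker]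
    have hp' := Finset.HasAntidiagonal.mem_antidiagonal.1 hp
    induction t with
    | zero => simp
    | add s t hs ht => rw [map_add, map_add, hs, ht, add_zero]
    | tmul u v =>
      rcases Nat.eq_zero_or_pos p.2 with h0 | h0
      · have := ha v (h0 ▸ v.2)
        simp [this]
      · have := hd p.1 (by omega) u u.2
        simp [this]
  have := key (h𝒢.comul_mem n x hx)
  exact this

theorem IsConnectedGradedHopf.conv_tmul_eq_zero (h𝒢 : IsConnectedGradedHopf 𝒢) {n i j : ℕ}
    {d a : WithConv (H ⊗[ℂ] H →ₗ[ℂ] K)}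
    (hd : ∀ k l, k + l < n → ∀ x ∈ 𝒢 k, ∀ y ∈ 𝒢 l, d (x ⊗ₜ y) = 0)
    (ha : ∀ x ∈ 𝒢 0, ∀ y ∈ 𝒢 0, a (x ⊗ₜ y) = 0) (hij : i + j = n)
    {x y : H} (hx : x ∈ 𝒢 i) (hy : y ∈ 𝒢 j) : (d * a) (x ⊗ₜ y) = 0 := by
  set W : ℕ → Submodule ℂ (H ⊗[ℂ] H) := fun n => ⨆ p ∈ Finset.HasAntidiagonal.antidiagonal n,
      LinearMap.range (TensorProduct.map (𝒢 p.1).subtype (𝒢 p.2).subtype) with hW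
  let B : H ⊗[ℂ] H →ₗ[ℂ] H ⊗[ℂ] H →ₗ[ℂ] K :=
    (TensorProduct.mk ℂ (H ⊗[ℂ] H) (H ⊗[ℂ] H)).compr₂
      (LinearMap.mul' ℂ K ∘ₗ TensorProduct.map d.ofConv a.ofConv ∘ₗ
        (TensorProduct.tensorTensorTensorComm ℂ H H H H).toLinearMap)
  have hB : ∀ s ∈ W i, ∀ t ∈ W j, B s t = 0 := by
    intro s hs t ht
    have h1 : W i ≤ LinearMap.ker (B.flip t) := by
      refine iSup₂_le fun p hp => ?_
      rintro _ ⟨s, rfl⟩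
      rw [LinearMap.mem_ker, LinearMap.flip_apply]
      have hp' := Finset.HasAntidiagonal.mem_antidiagonal.1 hp
      induction s with
      | zero => simp
      | add s t hs ht => rw [map_add, map_add, LinearMap.add_apply, hs, ht, add_zero]
      | tmul u v =>
        have h2 : W j ≤ LinearMap.ker (B (TensorProduct.map (𝒢 p.1).subtype (𝒢 p.2).subtype
            (u ⊗ₜ v))) := by
          refine iSup₂_le fun q hq => ?_
          rintro _ ⟨r, rfl⟩
          rw [LinearMap.mem_ker]
          have hq' := Finset.HasAntidiagonal.mem_antidiagonal.1 hq
          induction r with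
          | zero => simp
          | add s t hs ht => rw [map_add, map_add, hs, ht, add_zero]
          | tmul u' v' =>
            simp only [TensorProduct.map_tmul, Submodule.subtype_apply, B,
              LinearMap.compr₂_apply, TensorProduct.mk_apply, LinearMap.comp_apply,
              LinearEquiv.coe_coe, TensorProduct.tensorTensorTensorComm_tmul,
              LinearMap.mul'_apply]
            by_cases h0 : p.2 + q.2 = 0
            · have h02 : p.2 = 0 ∧ q.2 = 0 := by omega
              have := ha v (h02.1 ▸ v.2) v' (h02.2 ▸ v'.2)
              rw [this, mul_zero]
            · have := hd p.1 q.1 (by omega) u u.2 u' u'.2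
              rw [this, zero_mul]
        exact h2 ht
    exact h1 hs
  have := hB _ (h𝒢.comul_mem i x hx) _ (h𝒢.comul_mem j y hy)
  exact this

/-- The Birkhoff decomposition `g = g₋⁻¹ ⋆ g₊`, with `m = g₋` and `p = g₊`. -/
structure IsBirkhoff (g m p : CharGroup H (LaurentSeries R)) : Prop where
  eq : g = m⁻¹ * p
  regular : ∀ x, IsRegular (p x)
  polar : ∀ x, Coalgebra.counit (R := ℂ) x = 0 → IsPolar (m x)

theorem toLin_apply (g : CharGroup H K) (x : H) : g.toLin x = g x := rfl

theorem toLin_mul (g h : CharGroup H K) : (g * h).toLin = g.toLin * h.toLin := rfl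

theorem IsConnectedGradedHopf.mem_zero (h𝒢 : IsConnectedGradedHopf 𝒢) {x : H} (hx : x ∈ 𝒢 0) :
    ∃ c : ℂ, x = algebraMap ℂ H c := by
  rw [h𝒢.zero_eq, Submodule.mem_span_singleton] at hx
  obtain ⟨c, rfl⟩ := hx
  exact ⟨c, by rw [Algebra.algebraMap_eq_smul_one]⟩

theorem IsConnectedGradedHopf.toLin_sub_one (h𝒢 : IsConnectedGradedHopf 𝒢) (g : CharGroup H K) :
    ∀ x ∈ 𝒢 0, (g.toLin - 1) x = 0 := by
  intro x hx
  obtain ⟨c, rfl⟩ := h𝒢.mem_zero hx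
  change g.ofConv _ - (1 : LinForm H K) _ = 0
  simp

theorem IsConnectedGradedHopf.birkhoff_unique [GradedAlgebra 𝒢] (h𝒢 : IsConnectedGradedHopf 𝒢)
    {g m p m' p' : CharGroup H (LaurentSeries R)} (h : IsBirkhoff g m p)
    (h' : IsBirkhoff g m' p') : m = m' ∧ p = p' := by
  have e : p = m * g := by rw [h.eq]; group
  have e' : p' = m' * g := by rw [h'.eq]; group
  have hm : m = m' := by
    have key : ∀ n, ∀ x ∈ 𝒢 n, (m.toLin - m'.toLin) x = 0 := by
      intro n
      induction n using Nat.strong_induction_on with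
      | _ n ih =>
        intro x hx
        rcases Nat.eq_zero_or_pos n with rfl | hn
        · obtain ⟨c, rfl⟩ := h𝒢.mem_zero hx
          change m.ofConv _ - m'.ofConv _ = 0
          simp
        · have h1 := h𝒢.conv_eq_zero ih (h𝒢.toLin_sub_one g) hx
          rw [mul_sub, mul_one, sub_mul, ← toLin_mul, ← toLin_mul, ← e, ← e'] at h1
          have h2 : (m.toLin - m'.toLin) x = p x - p' x := by
            change (p x - p' x) - _ = 0 at h1
            exact (sub_eq_zero.1 h1).symm
          have hc := h𝒢.counit_eq_zero n hn.ne' x hx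
          refine eq_zero_of_isRegular_of_isPolar ?_ ((h.polar x hc).sub (h'.polar x hc))
          have := (h.regular x).sub (h'.regular x)
          rw [← h2] at this
          exact this
    apply WithConv.ext
    apply AlgHom.ext
    intro x
    refine DirectSum.Decomposition.inductionOn 𝒢 (motive := fun x => m.ofConv x = m'.ofConv x) ?_ ?_ ?_ x
    · simp
    · intro n y
      exact sub_eq_zero.1 (key n y y.2)
    · intro y z hy hz
      rw [map_add, map_add, hy, hz]
  exact ⟨hm, by rw [e, e', hm]⟩

/-- Auxiliary iteration for the construction of the counterterm. -/
def bogoliubovStep (a : LinForm H (LaurentSeries R)) (m : LinForm H (LaurentSeries R)) :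
    LinForm H (LaurentSeries R) :=
  1 - toConv (polarPart ∘ₗ (m * a).ofConv)

theorem bogoliubovStep_apply (a m : LinForm H (LaurentSeries R)) (x : H) :
    bogoliubovStep a m x = (1 : LinForm H (LaurentSeries R)) x - polarPart ((m * a) x) := rfl

theorem IsConnectedGradedHopf.exists_linear [GradedAlgebra 𝒢] (h𝒢 : IsConnectedGradedHopf 𝒢)
    (a : LinForm H (LaurentSeries R)) (ha : ∀ x ∈ 𝒢 0, a x = 0) :
    ∃ m : LinForm H (LaurentSeries R), m = bogoliubovStep a m := by
  let f : ℕ → LinForm H (LaurentSeries R) := fun k => (bogoliubovStep a)^[k] 1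
  have hf : ∀ k, f (k + 1) = bogoliubovStep a (f k) := fun k => Function.iterate_succ_apply' _ _ _
  have step : ∀ (u v : LinForm H (LaurentSeries R)) (n : ℕ),
      (∀ i < n, ∀ x ∈ 𝒢 i, (u - v) x = 0) → ∀ x ∈ 𝒢 n,
        bogoliubovStep a u x = bogoliubovStep a v x := by
    intro u v n h x hx
    have h1 := h𝒢.conv_eq_zero h ha hx
    rw [sub_mul] at h1
    have h2 : (u * a) x = (v * a) x := sub_eq_zero.1 h1
    rw [bogoliubovStep_apply, bogoliubovStep_apply, h2]
  have stab : ∀ k n, n ≤ k → ∀ x ∈ 𝒢 n, f (k + 1) x = f k x := by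
    intro k
    induction k with
    | zero =>
      intro n hn x hx
      obtain rfl : n = 0 := by omega
      have h0 : ((0 : LinForm H (LaurentSeries R)) * a) x = 0 := by rw [zero_mul]; rfl
      have h1 : ((1 : LinForm H (LaurentSeries R)) * a) x = 0 := by rw [one_mul]; exact ha x hx
      rw [hf, bogoliubovStep_apply]
      change _ - polarPart (((1 : LinForm H (LaurentSeries R)) * a) x) =
        (1 : LinForm H (LaurentSeries R)) x
      rw [h1, map_zero, sub_zero]
    | succ k ih =>
      intro n hn x hx
      rw [hf (k + 1), hf k]
      refine step _ _ n ?_ x hx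
      intro i hi y hy
      have := ih i (by omega) y hy
      rw [hf k] at this
      exact sub_eq_zero.2 (by rw [← hf k]; rw [hf k]; exact this)
  have stab' : ∀ n k, n ≤ k → ∀ x ∈ 𝒢 n, f k x = f n x := by
    intro n k hk
    induction k, hk using Nat.le_induction with
    | base => intro x _; rfl
    | succ k hk ih => intro x hx; rw [stab k n hk x hx, ih x hx]
  let m : LinForm H (LaurentSeries R) := toConv
    (DirectSum.toModule ℂ ℕ _ (fun n => (f n).ofConv ∘ₗ (𝒢 n).subtype) ∘ₗ
      (DirectSum.decomposeLinearEquiv 𝒢).toLinearMap)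
  have hm : ∀ n, ∀ x ∈ 𝒢 n, m x = f n x := by
    intro n x hx
    change (_ ∘ₗ _) x = _
    rw [LinearMap.comp_apply, LinearEquiv.coe_coe, DirectSum.decomposeLinearEquiv_apply,
      DirectSum.decompose_of_mem 𝒢 hx]
    exact DirectSum.toModule_lof ℂ n _
  refine ⟨m, ?_⟩
  apply WithConv.ext
  apply LinearMap.ext
  intro x
  refine DirectSum.Decomposition.inductionOn 𝒢
    (motive := fun x => m.ofConv x = (bogoliubovStep a m).ofConv x) ?_ ?_ ?_ x
  · simp
  · intro n y
    have h1 : bogoliubovStep a m y = bogoliubovStep a (f n) y := by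
      refine step _ _ n ?_ y y.2
      intro i hi z hz
      exact sub_eq_zero.2 ((hm i z hz).trans (stab' i n hi.le z hz).symm)
    rw [h1, ← hf, stab n n le_rfl y y.2]
    exact hm n y y.2
  · intro y z hy hz
    rw [map_add, map_add, hy, hz]

theorem IsConnectedGradedHopf.exists_birkhoff [GradedAlgebra 𝒢] (h𝒢 : IsConnectedGradedHopf 𝒢)
    (g : CharGroup H (LaurentSeries R)) : ∃ m p, IsBirkhoff g m p := by
  obtain ⟨m, hm⟩ := h𝒢.exists_linear (g.toLin - 1) (h𝒢.toLin_sub_one g)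
  have hm' : ∀ x, m x = (1 : LinForm H (LaurentSeries R)) x - polarPart ((m * (g.toLin - 1)) x) := by
    intro x
    conv_lhs => rw [hm]
    rfl
  set q : LinForm H (LaurentSeries R) := m * g.toLin with hq
  have hqreg : ∀ x, IsRegular (q x) := by
    intro x
    have h1 : q x = (m * (g.toLin - 1)) x + m x := by
      have : q = m * (g.toLin - 1) + m := by rw [hq]; noncomm_ring
      rw [this]; rfl
    rw [h1, hm' x]
    have h2 := isRegular_sub_polarPart ((m * (g.toLin - 1)) x)
    have h3 : IsRegular ((1 : LinForm H (LaurentSeries R)) x) := isRegular_smul_one _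
    intro n hn
    have h2' := h2 n hn
    have h3' := h3 n hn
    rw [HahnSeries.coeff_sub] at h2'
    rw [HahnSeries.coeff_add, HahnSeries.coeff_sub, h3', zero_sub, ← sub_eq_add_neg, h2']
  have hpol : ∀ x, Coalgebra.counit (R := ℂ) x = 0 → IsPolar (m x) := by
    intro x hx
    have : (1 : LinForm H (LaurentSeries R)) x = 0 := by
      rw [LinearMap.convOne_apply, hx, map_zero]
    rw [hm' x, this, zero_sub]
    intro n hn
    rw [HahnSeries.coeff_neg, isPolar_polarPart _ n hn, neg_zero]
  have hm0 : ∀ c : ℂ, m (algebraMap ℂ H c) = algebraMap ℂ _ c := by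
    intro c
    have h0 : algebraMap ℂ H c ∈ 𝒢 0 := by
      rw [h𝒢.zero_eq, Algebra.algebraMap_eq_smul_one]
      exact Submodule.smul_mem _ _ (Submodule.mem_span_singleton_self _)
    have := h𝒢.conv_eq_zero (n := 0) (d := m) (by omega) (h𝒢.toLin_sub_one g) h0
    rw [hm', this, map_zero, sub_zero, LinearMap.convOne_apply, Bialgebra.counit_algebraMap]
  -- multiplicativity
  let D : WithConv (H ⊗[ℂ] H →ₗ[ℂ] LaurentSeries R) :=
    toConv (m.ofConv ∘ₗ LinearMap.mul' ℂ H - LinearMap.mul' ℂ _ ∘ₗ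
      TensorProduct.map m.ofConv m.ofConv)
  let Φ : WithConv (H ⊗[ℂ] H →ₗ[ℂ] LaurentSeries R) :=
    toConv (g.ofConv.toLinearMap ∘ₗ LinearMap.mul' ℂ H)
  have hD : ∀ x y, D (x ⊗ₜ y) = m (x * y) - m x * m y := fun x y => rfl
  have hΦ : ∀ x y, Φ (x ⊗ₜ y) = g x * g y := fun x y => map_mul g.ofConv x y
  have hDΦ : ∀ x y, (D * Φ) (x ⊗ₜ y) = q (x * y) - q x * q y := by
    intro x y
    let ℛx := Coalgebra.Repr.arbitrary ℂ x
    let ℛy := Coalgebra.Repr.arbitrary ℂ y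
    rw [(ℛx.tmul ℛy).convMul_apply, hq, (ℛx.mul ℛy).convMul_apply, ℛx.convMul_apply,
      ℛy.convMul_apply, Finset.sum_mul_sum, ← Finset.sum_product']
    refine Eq.trans ?_ (Finset.sum_sub_distrib (s := ℛx.index ×ˢ ℛy.index) _ _)
    refine Finset.sum_congr rfl fun i _ => ?_
    change D (ℛx.left i.1 ⊗ₜ ℛy.left i.2) * Φ (ℛx.right i.1 ⊗ₜ ℛy.right i.2) =
      m (ℛx.left i.1 * ℛy.left i.2) * g (ℛx.right i.1 * ℛy.right i.2) -
       m (ℛx.left i.1) * g (ℛx.right i.1) * (m (ℛy.left i.2) * g (ℛy.right i.2))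
    rw [hD, hΦ, map_mul g.ofConv]
    ring
  have key : ∀ n i j, i + j = n → ∀ x ∈ 𝒢 i, ∀ y ∈ 𝒢 j, D (x ⊗ₜ y) = 0 := by
    intro n
    induction n using Nat.strong_induction_on with
    | _ n ih =>
      intro i j hij x hx y hy
      rcases Nat.eq_zero_or_pos i with rfl | hi
      · obtain ⟨c, rfl⟩ := h𝒢.mem_zero hx
        rw [hD, hm0, ← Algebra.smul_def, ← Algebra.smul_def]
        exact sub_eq_zero.2 (map_smul m.ofConv c y)
      rcases Nat.eq_zero_or_pos j with rfl | hj
      · obtain ⟨c, rfl⟩ := h𝒢.mem_zero hy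
        rw [hD, hm0, mul_comm, mul_comm (m x), ← Algebra.smul_def, ← Algebra.smul_def]
        exact sub_eq_zero.2 (map_smul m.ofConv c x)
      have h0 : (D * (Φ - 1)) (x ⊗ₜ y) = 0 := by
        refine h𝒢.conv_tmul_eq_zero (n := n) (fun k l hkl x hx y hy => ih _ hkl k l rfl x hx y hy) ?_
          hij hx hy
        intro x hx y hy
        obtain ⟨c, rfl⟩ := h𝒢.mem_zero hx
        obtain ⟨d, rfl⟩ := h𝒢.mem_zero hy
        change Φ _ - (1 : WithConv (H ⊗[ℂ] H →ₗ[ℂ] LaurentSeries R)) _ = 0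
        rw [hΦ, LinearMap.convOne_apply]
        simp [mul_comm]
      rw [mul_sub, mul_one] at h0
      have h1 : D (x ⊗ₜ y) = q (x * y) - q x * q y := by
        rw [← hDΦ]
        exact (sub_eq_zero.1 h0).symm
      refine eq_zero_of_isRegular_of_isPolar ?_ ?_
      · rw [h1]
        exact (hqreg _).sub ((hqreg _).mul (hqreg _))
      · rw [hD]
        have cx := h𝒢.counit_eq_zero i hi.ne' x hx
        have cy := h𝒢.counit_eq_zero j hj.ne' y hy
        refine (hpol _ ?_).sub ((hpol _ cx).mul (hpol _ cy))
        rw [Bialgebra.counit_mul, cx, zero_mul]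
  have hmul : ∀ x y, m (x * y) = m x * m y := by
    intro x y
    refine DirectSum.Decomposition.inductionOn 𝒢
      (motive := fun x => m.ofConv (x * y) = m.ofConv x * m.ofConv y) ?_ ?_ ?_ x
    · simp
    · intro i x
      refine DirectSum.Decomposition.inductionOn 𝒢
        (motive := fun y => m.ofConv (x * y) = m.ofConv x * m.ofConv y) ?_ ?_ ?_ y
      · simp
      · intro j y
        exact sub_eq_zero.1 (key _ i j rfl x x.2 y y.2)
      · intro y z hy hz
        rw [mul_add, map_add, map_add, mul_add, hy, hz]
    · intro y z hy hz
      rw [add_mul, map_add, map_add, add_mul, hy, hz]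
  let M : CharGroup H (LaurentSeries R) := toConv (AlgHom.ofLinearMap m.ofConv
    (by simpa using hm0 1) hmul)
  exact ⟨M, M * g, by group, hqreg, hpol⟩

/-- The counterterm `g₋` of the (unique) Birkhoff decomposition of `g`. -/
def counterterm [GradedAlgebra 𝒢] (h𝒢 : IsConnectedGradedHopf 𝒢)
    (g : CharGroup H (LaurentSeries R)) : CharGroup H (LaurentSeries R) :=
  (h𝒢.exists_birkhoff g).choose

end Birkhoff

/-- The derivation `∂/∂z`. -/
def dz : LaurentF →ₗ[ℂ] LaurentF := LaurentSeries.derivative ℂ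

/-- The derivation `∂/∂s = t ∂/∂t`. -/
def ds : LaurentF →ₗ[ℂ] LaurentF where
  toFun f := f.map EntireFun.deriv
  map_add' f g := by ext n; simp
  map_smul' c f := by ext n; simp

theorem EntireFun.deriv_mul (f g : EntireFun) :
    EntireFun.deriv (f * g) = EntireFun.deriv f * g + f * EntireFun.deriv g := by
  ext s
  exact _root_.deriv_mul (f.2 s) (g.2 s)

theorem ds_mul (f g : LaurentF) : ds (f * g) = ds f * g + f * ds g := by
  have hs : ∀ f : LaurentF, (ds f).support ⊆ f.support := by
    intro f n hn h0
    refine hn ?_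
    change EntireFun.deriv (f.coeff n) = 0
    rw [h0, map_zero]
  ext1
  funext n
  rw [HahnSeries.coeff_add, HahnSeries.coeff_mul_left' f.isPWO_support (hs f),
    HahnSeries.coeff_mul_right' g.isPWO_support (hs g), ← Finset.sum_add_distrib]
  change EntireFun.deriv ((f * g).coeff n) = _
  rw [HahnSeries.coeff_mul, map_sum]
  exact Finset.sum_congr rfl fun ij _ => EntireFun.deriv_mul _ _

theorem dz_mul (f g : LaurentF) : dz (f * g) = dz f * g + f * dz g := by
  let θ : LaurentF → LaurentF := fun f => HahnSeries.single 1 1 * dz f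
  have hθ : ∀ (f : LaurentF) (n : ℤ), (θ f).coeff n = n • f.coeff n := by
    intro f n
    have := HahnSeries.coeff_single_mul_add (r := (1 : EntireFun)) (x := dz f) (a := n - 1) (b := 1)
    rw [sub_add_cancel] at this
    rw [this, one_mul, dz, LaurentSeries.derivative_apply, LaurentSeries.hasseDeriv_coeff]
    simp
  have hdz : ∀ f : LaurentF, dz f = HahnSeries.single (-1) 1 * θ f := by
    intro f
    rw [← mul_assoc, HahnSeries.single_mul_single]
    simp
  have hs : ∀ f : LaurentF, (θ f).support ⊆ f.support := by
    intro f n hn h0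
    refine hn ?_
    change (θ f).coeff n = 0
    rw [hθ, h0, smul_zero]
  have key : θ (f * g) = θ f * g + f * θ g := by
    ext1
    funext n
    rw [HahnSeries.coeff_add, HahnSeries.coeff_mul_left' f.isPWO_support (hs f),
      HahnSeries.coeff_mul_right' g.isPWO_support (hs g), ← Finset.sum_add_distrib, hθ,
      HahnSeries.coeff_mul, Finset.smul_sum]
    refine Finset.sum_congr rfl fun ij hij => ?_
    rw [hθ, hθ, ← (Finset.mem_antidiagonal.1 hij).2.2, add_smul, smul_mul_assoc, mul_smul_comm]
  rw [hdz, key, hdz f, hdz g]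
  ring

/-- The one-form `z dz + s dt/t` (with `dt/t = ds`), with values in the convolution algebra. -/
@[ext] structure OneForm (H : Type*) [CommRing H] [HopfAlgebra ℂ H] where
  z : LinForm H LaurentF
  s : LinForm H LaurentF

/-- Apply a linear operator to the values. -/
def LinForm.map (T : K →ₗ[ℂ] K) (a : LinForm H K) : LinForm H K := toConv (T ∘ₗ a.ofConv)

/-- The logarithmic derivative `D g = g⁻¹ ⋆ d g`. -/
def logD (g : CharGroup H LaurentF) : OneForm H where
  z := g⁻¹.toLin * LinForm.map dz g.toLin
  s := g⁻¹.toLin * LinForm.map ds g.toLin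

/-- The gauge transform `D ψ + ψ⁻¹ ⋆ η ⋆ ψ`. -/
def gaugeTransform (ψ : CharGroup H LaurentF) (η : OneForm H) : OneForm H where
  z := (logD ψ).z + ψ⁻¹.toLin * η.z * ψ.toLin
  s := (logD ψ).s + ψ⁻¹.toLin * η.s * ψ.toLin

/-- A connection on the trivial bundle `P* → B*`, given by its pullbacks along all sections. -/
structure Connection (H : Type*) [CommRing H] [HopfAlgebra ℂ H] where
  pullback : CharGroup H LaurentF → OneForm H
  pullback_mul : ∀ f ψ, pullback (f * ψ) = gaugeTransform ψ (pullback f)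

theorem LinForm.map_mul {T : K →ₗ[ℂ] K} (hT : ∀ a b, T (a * b) = T a * b + a * T b)
    (a b : LinForm H K) : LinForm.map T (a * b) = LinForm.map T a * b + a * LinForm.map T b := by
  apply WithConv.ext
  apply LinearMap.ext
  intro x
  let r := Coalgebra.Repr.arbitrary ℂ x
  change T ((a * b) x) = (LinForm.map T a * b) x + (a * LinForm.map T b) x
  rw [r.convMul_apply, r.convMul_apply, r.convMul_apply, map_sum, ← Finset.sum_add_distrib]
  exact Finset.sum_congr rfl fun i _ => hT _ _

/-- The connection with pullbacks `f^* ω = D f`. -/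
def flatConnection (H : Type*) [CommRing H] [HopfAlgebra ℂ H] : Connection H where
  pullback := logD
  pullback_mul f ψ := by
    have h1 : f⁻¹.toLin * f.toLin = 1 := by rw [← toLin_mul, inv_mul_cancel]; rfl
    have key : ∀ T : LaurentF →ₗ[ℂ] LaurentF, (∀ a b, T (a * b) = T a * b + a * T b) →
        (f * ψ)⁻¹.toLin * LinForm.map T (f * ψ).toLin = ψ⁻¹.toLin * LinForm.map T ψ.toLin +
          ψ⁻¹.toLin * (f⁻¹.toLin * LinForm.map T f.toLin) * ψ.toLin := by
      intro T hT
      rw [mul_inv_rev, toLin_mul, toLin_mul, LinForm.map_mul hT]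
      have : ψ⁻¹.toLin * LinForm.map T ψ.toLin =
          ψ⁻¹.toLin * (f⁻¹.toLin * f.toLin) * LinForm.map T ψ.toLin := by rw [h1, mul_one]
      rw [this]
      noncomm_ring
      abel
    exact OneForm.ext (key dz dz_mul) (key ds ds_mul)

/-- The function `t^z = exp (s z)`. -/
def expSZ : LaurentF :=
  HahnSeries.ofPowerSeries ℤ EntireFun <| PowerSeries.mk fun k =>
    ⟨fun s => s ^ k / (k.factorial : ℂ), by
      change Differentiable ℂ fun s : ℂ => s ^ k / (k.factorial : ℂ)
      fun_prop⟩

variable (𝒢 : ℕ → Submodule ℂ H) [GradedAlgebra 𝒢]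

/-- A character with values in `𝒜`, viewed as a family that does not depend on `t`. -/
def constSection (γ : CharGroup H LaurentA) : CharGroup H LaurentF :=
  toConv (constFamily.comp γ.ofConv)

/-- The section `γ_{t^z} = t^{zY} γ`. -/
def runningSection (γ : CharGroup H LaurentA) : CharGroup H LaurentF :=
  scale 𝒢 expSZ (constSection γ)

/-- The map `R̃(g) = g⁻¹ ⋆ Y(g)`. -/
def rTilde (g : CharGroup H K) : LinForm H K :=
  g⁻¹.toLin * toConv (g.ofConv.toLinearMap ∘ₗ degreeOp 𝒢)

/-- The locality condition: the counterterm of `γ_{t^z}` does not depend on `t`. -/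
def IsLocal {𝒢 : ℕ → Submodule ℂ H} [GradedAlgebra 𝒢] (h𝒢 : IsConnectedGradedHopf 𝒢)
    (γ : CharGroup H LaurentA) : Prop :=
  ∀ x, ds (counterterm h𝒢 (runningSection 𝒢 γ) x) = 0

/-- The family `g⁻¹ ⋆ t^{zY} g`. -/
def renormFlow (g : CharGroup H LaurentA) : CharGroup H LaurentF :=
  (constSection g)⁻¹ * runningSection 𝒢 g

/-- The limit of `g⁻¹ ⋆ t^{zY} g` for `z → 0` exists. -/
def HasBeta (g : CharGroup H LaurentA) : Prop := ∀ x, IsRegular (renormFlow 𝒢 g x)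

/-- The `β`-function `β(g) = d/dt|_{t=1} lim_{z → 0} g⁻¹ ⋆ t^{zY} g`; meaningful when `HasBeta 𝒢 g`. -/
def beta (g : CharGroup H LaurentA) : LinForm H ℂ :=
  toConv ((LinearMap.proj (R := ℂ) (φ := fun _ : ℂ => ℂ) 0 ∘ₗ EntireFun.toSubmodule.subtype ∘ₗ
    EntireFun.deriv) ∘ₗ HahnSeries.coeff.linearMap (R := ℂ) 0 ∘ₗ
      (renormFlow 𝒢 g).ofConv.toLinearMap)

/-- The value at `z = 0` of a regular character. -/
def valueAtZero (g : CharGroup H LaurentA) : LinForm H ℂ :=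
  toConv (HahnSeries.coeff.linearMap (R := ℂ) 0 ∘ₗ g.ofConv.toLinearMap)

/-- Elements of the Lie algebra `𝔤(K)`: infinitesimal characters. -/
def IsInfinitesimal (α : LinForm H K) : Prop :=
  ∀ x y, α (x * y) = α x * algebraMap ℂ K (Coalgebra.counit y) +
    algebraMap ℂ K (Coalgebra.counit x) * α y

/-- The two readings of the coefficient algebra: formal or convergent Laurent series. -/
inductive SeriesKind where
  | formal
  | convergent

/-- Membership in the coefficient algebra `𝒜`. In the convergent case the series converges in
`0 < |z| < 1 / ρ`. -/
def SeriesKind.Mem : SeriesKind → LaurentA → Prop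
  | formal, _ => True
  | convergent, f => ∃ C ρ : ℝ, 0 < ρ ∧ ∀ n : ℤ, ‖f.coeff n‖ ≤ C * ρ ^ n

/-- Membership in the algebra of families over `Δ* × {t}`. In the convergent case the family is
jointly holomorphic: it converges for `0 < |z| < 1 / ρ`, locally uniformly in `s`. -/
def SeriesKind.MemFamily : SeriesKind → LaurentF → Prop
  | formal, _ => True
  | convergent, f => ∀ r : ℝ, ∃ C ρ : ℝ, 0 < ρ ∧
      ∀ s : ℂ, ‖s‖ ≤ r → ∀ n : ℤ, ‖(f.coeff n : ℂ → ℂ) s‖ ≤ C * ρ ^ n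

/-- The group `G(𝒜)`. -/
def charsA (H : Type*) [CommRing H] [HopfAlgebra ℂ H] (k : SeriesKind) :
    Set (CharGroup H LaurentA) :=
  {γ | ∀ x, k.Mem (γ x)}

/-- The gauge group `G(𝒜₊)_t` of sections that are regular in `z` and `t`. -/
def gaugeGroup (H : Type*) [CommRing H] [HopfAlgebra ℂ H] (k : SeriesKind) :
    Set (CharGroup H LaurentF) :=
  {ψ | ∀ x, IsRegular (ψ x) ∧ k.MemFamily (ψ x)}

/-- Gauge equivalence of pullbacks under `G(𝒜₊)`. -/
def GaugeEquiv (k : SeriesKind) (η η' : OneForm H) : Prop :=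
  ∃ ψ ∈ gaugeGroup H k, η' = gaugeTransform ψ η

end
end Renormalization

open Renormalization

/-!
# The β-function and the gauge class of a local character

All three invariants in the theorem, `R̃((γ_{t^z})₋)`, `β(γ₋⁻¹)` and the class of `γ_{t^z}` modulo
gauge transformations that are regular in `z` and `t`, determine and are determined by the
counterterm `γ₋`. The gauge equivalence of the pullbacks is then the transformation law of the
connection.

*Locality.* If the counterterm of `γ_{t^z}` does not depend on `t`, it equals its value at `t = 1`.
That value belongs to a Birkhoff decomposition of `γ`, so by uniqueness it is `γ₋`
(`IsLocal.counterterm_runningSection`). Hence `γ₋ ⋆ γ_{t^z}` has no pole. Both flows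
`g⁻¹ ⋆ t^{zY} g`, for `g = γ₋⁻¹` and for `g = γ`, arise from it by multiplication with regular
characters, so the limits defining `β` exist.

*β and `R̃`.* The flow `g⁻¹ ⋆ t^{zY} g` has derivative `z R̃(g)` at `t = 1`
(`derivAtOne_renormFlow`), so `β(g)` is the coefficient of `z⁻¹` in `R̃(g)`. The cocycle identity
`R̃(f ⋆ g) = g⁻¹ ⋆ R̃(f) ⋆ g + R̃(g)` yields the conjugation formula for `β(γ)`, since `z R̃(γ₊)`
vanishes at `z = 0`. Since `γ₋⁻¹` is polar on the augmentation ideal, so is `R̃(γ₋⁻¹)`; since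
`z R̃(γ₋⁻¹)` is regular, `R̃(γ₋⁻¹) = β(γ₋⁻¹) / z` (`HasBeta.rTilde_apply_eq`).

*Rigidity.* The equation `Y g = g ⋆ R̃(g)` determines `g` from `R̃(g)` by recursion on the degree
(`rTilde_injective`). Thus `β(γ₋⁻¹)` determines `R̃(γ₋⁻¹)` and with it `γ₋`, and so does
`R̃((γ_{t^z})₋)`. If `γ₋ = γ'₋`, then `ψ = γ_{t^z}⁻¹ ⋆ γ'_{t^z}` is the quotient of the regular
characters `γ₋ ⋆ γ_{t^z}` and `γ₋ ⋆ γ'_{t^z}`; conversely a regular right factor does not change the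
counterterm. In the convergent reading `ψ` is convergent because the convergent families form a ring
that contains `t^z` (`SeriesKind.family`, `SeriesKind.memFamily_expSZ`).
-/

namespace Renormalization

open WithConv TensorProduct

/-! ### Convolution and the grading -/

section Algebra

variable {H : Type*} [CommRing H] [HopfAlgebra ℂ H] {K : Type*} [CommRing K] [Algebra ℂ K]
  {L : Type*} [CommRing L] [Algebra ℂ L] {𝒢 : ℕ → Submodule ℂ H}

theorem LinForm.ext_apply {a b : LinForm H K} (h : ∀ x, a x = b x) : a = b :=
  WithConv.ext (LinearMap.ext h)

theorem CharGroup.ext_apply {f g : CharGroup H K} (h : ∀ x, f x = g x) : f = g :=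
  WithConv.ext (AlgHom.ext h)

theorem LinForm.ext_homogeneous [GradedAlgebra 𝒢] {a b : LinForm H K}
    (h : ∀ n, ∀ x ∈ 𝒢 n, a x = b x) : a = b := by
  refine LinForm.ext_apply fun x => ?_
  refine DirectSum.Decomposition.inductionOn 𝒢
    (motive := fun x => a.ofConv x = b.ofConv x) ?_ ?_ ?_ x
  · simp
  · exact fun {n} y => h n y y.2
  · intro y z hy hz
    rw [map_add, map_add, hy, hz]

theorem CharGroup.ext_homogeneous [GradedAlgebra 𝒢] {f g : CharGroup H K}
    (h : ∀ n, ∀ x ∈ 𝒢 n, f x = g x) : f = g :=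
  CharGroup.ext_apply fun x =>
    congrArg (fun a : LinForm H K => a x)
      (LinForm.ext_homogeneous (a := f.toLin) (b := g.toLin) h)

/-- A linear map on `H ⊗ H` is determined on the coproduct of a homogeneous element by its values
on tensors of homogeneous elements of complementary degrees. -/
theorem IsConnectedGradedHopf.eq_on_comul (h𝒢 : IsConnectedGradedHopf 𝒢) {n : ℕ}
    {F G : H ⊗[ℂ] H →ₗ[ℂ] K}
    (h : ∀ i j, i + j = n → ∀ x ∈ 𝒢 i, ∀ y ∈ 𝒢 j, F (x ⊗ₜ y) = G (x ⊗ₜ y))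
    {x : H} (hx : x ∈ 𝒢 n) : F (Coalgebra.comul x) = G (Coalgebra.comul x) := by
  have key : (⨆ p ∈ Finset.HasAntidiagonal.antidiagonal n,
      LinearMap.range (TensorProduct.map (𝒢 p.1).subtype (𝒢 p.2).subtype)) ≤
      LinearMap.eqLocus F G := by
    refine iSup₂_le fun p hp => ?_
    rintro _ ⟨t, rfl⟩
    rw [LinearMap.mem_eqLocus]
    induction t with
    | zero => simp
    | add s t hs ht => rw [map_add, map_add, map_add, hs, ht]
    | tmul u v =>
      exact h p.1 p.2 (Finset.HasAntidiagonal.mem_antidiagonal.1 hp) u u.2 v v.2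
  exact key (h𝒢.comul_mem n x hx)

theorem scale_mul [GradedAlgebra 𝒢] (h𝒢 : IsConnectedGradedHopf 𝒢) (u : K)
    (f g : CharGroup H K) : scale 𝒢 u (f * g) = scale 𝒢 u f * scale 𝒢 u g := by
  refine CharGroup.ext_homogeneous (𝒢 := 𝒢) fun n x hx => ?_
  rw [scale_apply 𝒢 u _ n x hx]
  refine h𝒢.eq_on_comul (F := LinearMap.mulLeft ℂ (u ^ n) ∘ₗ LinearMap.mul' ℂ K ∘ₗ
      TensorProduct.map f.toLin.ofConv g.toLin.ofConv)
    (G := LinearMap.mul' ℂ K ∘ₗ TensorProduct.map (scale 𝒢 u f).toLin.ofConv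
      (scale 𝒢 u g).toLin.ofConv) ?_ hx
  intro i j hij y hy z hz
  change u ^ n * (f y * g z) = scale 𝒢 u f y * scale 𝒢 u g z
  rw [scale_apply 𝒢 u _ i y hy, scale_apply 𝒢 u _ j z hz, ← hij, pow_add, mul_mul_mul_comm]

/-- The operator `Y` on linear forms: precomposition with the grading operator. -/
noncomputable def gradeOp (𝒢 : ℕ → Submodule ℂ H) [GradedAlgebra 𝒢] (a : LinForm H K) :
    LinForm H K :=
  toConv (a.ofConv ∘ₗ degreeOp 𝒢)

theorem gradeOp_apply [GradedAlgebra 𝒢] (a : LinForm H K) {n : ℕ} {x : H} (hx : x ∈ 𝒢 n) :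
    gradeOp 𝒢 a x = (n : ℂ) • a x := by
  change a.ofConv (degreeOp 𝒢 x) = _
  rw [degreeOp_apply 𝒢 n x hx, map_smul]

theorem gradeOp_mul [GradedAlgebra 𝒢] (h𝒢 : IsConnectedGradedHopf 𝒢) (a b : LinForm H K) :
    gradeOp 𝒢 (a * b) = gradeOp 𝒢 a * b + a * gradeOp 𝒢 b := by
  refine LinForm.ext_homogeneous (𝒢 := 𝒢) fun n x hx => ?_
  rw [gradeOp_apply _ hx]
  refine h𝒢.eq_on_comul (F := (n : ℂ) • LinearMap.mul' ℂ K ∘ₗ TensorProduct.map a.ofConv b.ofConv)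
    (G := LinearMap.mul' ℂ K ∘ₗ TensorProduct.map (gradeOp 𝒢 a).ofConv b.ofConv +
      LinearMap.mul' ℂ K ∘ₗ TensorProduct.map a.ofConv (gradeOp 𝒢 b).ofConv) ?_ hx
  intro i j hij y hy z hz
  change (n : ℂ) • (a y * b z) = gradeOp 𝒢 a y * b z + a y * gradeOp 𝒢 b z
  rw [gradeOp_apply _ hy, gradeOp_apply _ hz, ← hij, smul_mul_assoc, mul_smul_comm, ← add_smul,
    Nat.cast_add]

theorem rTilde_eq [GradedAlgebra 𝒢] (g : CharGroup H K) :
    rTilde 𝒢 g = g⁻¹.toLin * gradeOp 𝒢 g.toLin := rfl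

theorem CharGroup.toLin_inv_mul_self (g : CharGroup H K) : g⁻¹.toLin * g.toLin = 1 := by
  rw [← toLin_mul, inv_mul_cancel]; rfl

theorem CharGroup.toLin_mul_inv_self (g : CharGroup H K) : g.toLin * g⁻¹.toLin = 1 := by
  rw [← toLin_mul, mul_inv_cancel]; rfl

theorem CharGroup.inv_apply (g : CharGroup H K) (x : H) :
    g⁻¹ x = g (HopfAlgebra.antipode ℂ x) := rfl

theorem gradeOp_toLin [GradedAlgebra 𝒢] (g : CharGroup H K) :
    gradeOp 𝒢 g.toLin = g.toLin * rTilde 𝒢 g := by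
  rw [rTilde_eq, ← mul_assoc, g.toLin_mul_inv_self, one_mul]

theorem rTilde_mul [GradedAlgebra 𝒢] (h𝒢 : IsConnectedGradedHopf 𝒢) (f g : CharGroup H K) :
    rTilde 𝒢 (f * g) = g⁻¹.toLin * rTilde 𝒢 f * g.toLin + rTilde 𝒢 g := by
  rw [rTilde_eq, toLin_mul, gradeOp_mul h𝒢, mul_inv_rev, toLin_mul, rTilde_eq, rTilde_eq]
  have : g⁻¹.toLin * f⁻¹.toLin * (f.toLin * gradeOp 𝒢 g.toLin) =
      g⁻¹.toLin * (f⁻¹.toLin * f.toLin) * gradeOp 𝒢 g.toLin := by simp only [mul_assoc]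
  rw [mul_add, this, f.toLin_inv_mul_self, mul_one]
  simp only [mul_assoc]

theorem rTilde_apply_zero [GradedAlgebra 𝒢] (h𝒢 : IsConnectedGradedHopf 𝒢) (g : CharGroup H K)
    {x : H} (hx : x ∈ 𝒢 0) : rTilde 𝒢 g x = 0 := by
  rw [rTilde_eq]
  refine h𝒢.conv_eq_zero (n := 0) (by omega) (fun y hy => ?_) hx
  rw [gradeOp_apply _ hy, Nat.cast_zero, zero_smul]

/-- The operator `R̃` is injective: `Y g = g ⋆ R̃(g)` determines `g` by recursion on the degree. -/
theorem rTilde_injective [GradedAlgebra 𝒢] (h𝒢 : IsConnectedGradedHopf 𝒢) :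
    Function.Injective (rTilde 𝒢 : CharGroup H K → LinForm H K) := by
  intro f g hfg
  have key : ∀ n, ∀ x ∈ 𝒢 n, (f.toLin - g.toLin) x = 0 := by
    intro n
    induction n using Nat.strong_induction_on with
    | _ n ih =>
      intro x hx
      rcases Nat.eq_zero_or_pos n with rfl | hn
      · obtain ⟨c, rfl⟩ := h𝒢.mem_zero hx
        change f.ofConv _ - g.ofConv _ = 0
        simp
      · have h := h𝒢.conv_eq_zero ih (fun y hy => rTilde_apply_zero h𝒢 f hy) hx
        have e : (f.toLin - g.toLin) * rTilde 𝒢 f = gradeOp 𝒢 (f.toLin - g.toLin) := by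
          rw [sub_mul, ← gradeOp_toLin, hfg, ← gradeOp_toLin]
          rfl
        rw [e, gradeOp_apply _ hx] at h
        exact (smul_eq_zero.1 h).resolve_left (Nat.cast_ne_zero.2 hn.ne')
  exact CharGroup.ext_homogeneous (𝒢 := 𝒢) fun n x hx => sub_eq_zero.1 (key n x hx)

theorem counit_degreeOp [GradedAlgebra 𝒢] (h𝒢 : IsConnectedGradedHopf 𝒢) (x : H) :
    Coalgebra.counit (R := ℂ) (degreeOp 𝒢 x) = 0 := by
  have h : gradeOp 𝒢 (1 : LinForm H ℂ) = 0 := by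
    refine LinForm.ext_homogeneous (𝒢 := 𝒢) fun n x hx => ?_
    rw [gradeOp_apply _ hx]
    rcases Nat.eq_zero_or_pos n with rfl | hn
    · rw [Nat.cast_zero, zero_smul]; rfl
    · rw [LinearMap.convOne_apply, h𝒢.counit_eq_zero n hn.ne' x hx, map_zero, smul_zero]; rfl
  exact congrArg (fun a : LinForm H ℂ => a x) h

/-- Postcomposition of a linear form with a linear map of the coefficients. -/
def LinForm.post (T : K →ₗ[ℂ] L) (a : LinForm H K) : LinForm H L := toConv (T ∘ₗ a.ofConv)

theorem LinForm.post_apply (T : K →ₗ[ℂ] L) (a : LinForm H K) (x : H) :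
    LinForm.post T a x = T (a x) := rfl

theorem LinForm.post_mul_of_leibniz {T : K →ₗ[ℂ] L} {φ : K →ₐ[ℂ] L}
    (hT : ∀ a b, T (a * b) = T a * φ b + φ a * T b) (a b : LinForm H K) :
    LinForm.post T (a * b) = LinForm.post T a * LinForm.post φ.toLinearMap b +
      LinForm.post φ.toLinearMap a * LinForm.post T b := by
  refine LinForm.ext_apply fun x => ?_
  let r := Coalgebra.Repr.arbitrary ℂ x
  change T ((a * b) x) = (LinForm.post T a * LinForm.post φ.toLinearMap b) x +
    (LinForm.post φ.toLinearMap a * LinForm.post T b) x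
  rw [r.convMul_apply, r.convMul_apply, r.convMul_apply, map_sum, ← Finset.sum_add_distrib]
  exact Finset.sum_congr rfl fun i _ => hT _ _

/-- Multiplication of a linear form by an element of the coefficient algebra. -/
def LinForm.scalarMul (u : K) (a : LinForm H K) : LinForm H K :=
  LinForm.post (LinearMap.mulLeft ℂ u) a

theorem LinForm.scalarMul_apply (u : K) (a : LinForm H K) (x : H) :
    LinForm.scalarMul u a x = u * a x := rfl

theorem LinForm.scalarMul_mul (u : K) (a b : LinForm H K) :
    LinForm.scalarMul u (a * b) = LinForm.scalarMul u a * b := by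
  refine LinForm.ext_apply fun x => ?_
  let r := Coalgebra.Repr.arbitrary ℂ x
  rw [LinForm.scalarMul_apply, r.convMul_apply, r.convMul_apply, Finset.mul_sum]
  exact Finset.sum_congr rfl fun i _ => (mul_assoc _ _ _).symm

theorem LinForm.mul_scalarMul (u : K) (a b : LinForm H K) :
    a * LinForm.scalarMul u b = LinForm.scalarMul u (a * b) := by
  refine LinForm.ext_apply fun x => ?_
  let r := Coalgebra.Repr.arbitrary ℂ x
  rw [LinForm.scalarMul_apply, r.convMul_apply, r.convMul_apply, Finset.mul_sum]
  exact Finset.sum_congr rfl fun i _ => mul_left_comm _ _ _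

theorem LinForm.scalarMul_add (u : K) (a b : LinForm H K) :
    LinForm.scalarMul u (a + b) = LinForm.scalarMul u a + LinForm.scalarMul u b :=
  LinForm.ext_apply fun _ => mul_add _ _ _

theorem LinForm.post_add (T : K →ₗ[ℂ] L) (a b : LinForm H K) :
    LinForm.post T (a + b) = LinForm.post T a + LinForm.post T b :=
  LinForm.ext_apply fun _ => map_add T _ _

/-- The group homomorphism `G(K) → G(L)` induced by an algebra homomorphism `K → L`. -/
def CharGroup.mapHom (T : K →ₐ[ℂ] L) : CharGroup H K →* CharGroup H L where
  toFun f := toConv (T.comp f.ofConv)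
  map_one' := CharGroup.ext_apply fun _ => T.commutes _
  map_mul' f g := congrArg toConv (AlgHom.comp_convMul_distrib T f g)

theorem CharGroup.mapHom_apply (T : K →ₐ[ℂ] L) (f : CharGroup H K) (x : H) :
    CharGroup.mapHom T f x = T (f x) := rfl

theorem LinForm.mul_mem (S : AddSubmonoid L) {a b : LinForm H L} (h : ∀ x y, a x * b y ∈ S)
    (x : H) : (a * b) x ∈ S := by
  rw [(Coalgebra.Repr.arbitrary ℂ x).convMul_apply]
  exact sum_mem fun i _ => h _ _

end Algebra

/-! ### Regular and polar Laurent series -/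

section Laurent

variable {R : Type*} [CommRing R] [Algebra ℂ R] {H : Type*} [CommRing H] [HopfAlgebra ℂ H]

theorem IsRegular.coeff_zero_mul {R : Type*} [CommRing R] {f g : LaurentSeries R}
    (hf : IsRegular f) (hg : IsRegular g) : (f * g).coeff 0 = f.coeff 0 * g.coeff 0 := by
  have h : ∀ {f : LaurentSeries R}, IsRegular f → ∃ p : PowerSeries R,
      HahnSeries.ofPowerSeries ℤ R p = f := by
    intro f hf
    refine ⟨PowerSeries.mk fun n => f.coeff n, ?_⟩
    ext n
    rcases lt_or_ge n 0 with hn | hn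
    · rw [hf n hn]
      exact HahnSeries.embDomain_of_notMem_range
        (by rintro ⟨m, rfl⟩; exact absurd hn (not_lt.2 (Int.natCast_nonneg m)))
    · lift n to ℕ using hn
      rw [HahnSeries.ofPowerSeries_apply_coeff, PowerSeries.coeff_mk]
  obtain ⟨p, rfl⟩ := h hf
  obtain ⟨q, rfl⟩ := h hg
  have h0 : ∀ r : PowerSeries R, (HahnSeries.ofPowerSeries ℤ R r).coeff 0 =
      PowerSeries.constantCoeff r := fun r => by
    rw [← PowerSeries.coeff_zero_eq_constantCoeff_apply]
    exact HahnSeries.ofPowerSeries_apply_coeff r 0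
  rw [← map_mul, h0, h0, h0, map_mul]

theorem coeff_single_one_mul {R : Type*} [CommRing R] (f : LaurentSeries R) (n : ℤ) :
    (HahnSeries.single (1 : ℤ) (1 : R) * f).coeff n = f.coeff (n - 1) := by
  have := HahnSeries.coeff_single_mul_add (r := (1 : R)) (x := f) (a := n - 1) (b := (1 : ℤ))
  rwa [sub_add_cancel, one_mul] at this

/-- The additive monoid of series without pole. -/
def regularSeries (R : Type*) [CommRing R] : AddSubmonoid (LaurentSeries R) where
  carrier := {f | IsRegular f}
  zero_mem' _ _ := rfl
  add_mem' hf hg n hn := by rw [HahnSeries.coeff_add, hf n hn, hg n hn, add_zero]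

/-- The additive monoid of series with only negative powers. -/
def polarSeries (R : Type*) [CommRing R] : AddSubmonoid (LaurentSeries R) where
  carrier := {f | IsPolar f}
  zero_mem' _ _ := rfl
  add_mem' hf hg n hn := by rw [HahnSeries.coeff_add, hf n hn, hg n hn, add_zero]

theorem LinForm.isRegular_mul {a b : LinForm H (LaurentSeries R)} (ha : ∀ x, IsRegular (a x))
    (hb : ∀ x, IsRegular (b x)) (x : H) : IsRegular ((a * b) x) :=
  LinForm.mul_mem (regularSeries R) (fun y z => (ha y).mul (hb z)) x

theorem CharGroup.isRegular_mul {f g : CharGroup H (LaurentSeries R)} (hf : ∀ x, IsRegular (f x))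
    (hg : ∀ x, IsRegular (g x)) (x : H) : IsRegular ((f * g) x) :=
  LinForm.isRegular_mul (a := f.toLin) (b := g.toLin) hf hg x

theorem CharGroup.isRegular_inv {g : CharGroup H (LaurentSeries R)} (hg : ∀ x, IsRegular (g x))
    (x : H) : IsRegular (g⁻¹ x) := hg _

theorem isPolar_algebraMap_mul (c : ℂ) {f : LaurentSeries R} (hf : IsPolar f) :
    IsPolar (algebraMap ℂ (LaurentSeries R) c * f) := fun n hn => by
  rw [← Algebra.smul_def, HahnSeries.coeff_smul, hf n hn, smul_zero]

/-- If `g` is polar on the augmentation ideal, then `R̃(g)` is polar on all of `H`, because the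
grading operator maps `H` into the augmentation ideal. -/
theorem isPolar_rTilde {𝒢 : ℕ → Submodule ℂ H} [GradedAlgebra 𝒢] (h𝒢 : IsConnectedGradedHopf 𝒢)
    {g : CharGroup H (LaurentSeries R)}
    (hg : ∀ x, Coalgebra.counit (R := ℂ) x = 0 → IsPolar (g x)) (x : H) :
    IsPolar (rTilde 𝒢 g x) := by
  refine LinForm.mul_mem (polarSeries R) (fun y z => ?_) x
  have hz : IsPolar (gradeOp 𝒢 g.toLin z) := hg _ (counit_degreeOp h𝒢 z)
  -- `g⁻¹ y` is a constant plus a polar series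
  set c : ℂ := Coalgebra.counit (R := ℂ) y
  have hy : IsPolar (g⁻¹ (y - algebraMap ℂ H c)) := by
    rw [CharGroup.inv_apply]
    refine hg _ ?_
    rw [HopfAlgebra.counit_antipode, map_sub, Bialgebra.counit_algebraMap]
    exact sub_self _
  have e : g⁻¹ y = g⁻¹ (y - algebraMap ℂ H c) + algebraMap ℂ _ c := by
    have h1 : g⁻¹ (y - algebraMap ℂ H c) = g⁻¹ y - algebraMap ℂ _ c :=
      (map_sub g⁻¹.ofConv _ _).trans (congrArg _ (g⁻¹.ofConv.commutes c))
    rw [h1, sub_add_cancel]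
  change g⁻¹ y * gradeOp 𝒢 g.toLin z ∈ _
  rw [e, add_mul]
  exact (polarSeries R).add_mem (hy.mul hz) (isPolar_algebraMap_mul c hz)

variable {𝒢 : ℕ → Submodule ℂ H} [GradedAlgebra 𝒢] (h𝒢 : IsConnectedGradedHopf 𝒢)

theorem isBirkhoff_counterterm (g : CharGroup H (LaurentSeries R)) :
    IsBirkhoff g (counterterm h𝒢 g) (counterterm h𝒢 g * g) := by
  have h : ∃ p, IsBirkhoff g (counterterm h𝒢 g) p := (h𝒢.exists_birkhoff g).choose_spec
  obtain ⟨p, hp⟩ := h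
  rwa [← eq_inv_mul_iff_mul_eq.1 hp.eq] at hp

theorem IsBirkhoff.counterterm_eq {g m p : CharGroup H (LaurentSeries R)}
    (h : IsBirkhoff g m p) : counterterm h𝒢 g = m :=
  (h𝒢.birkhoff_unique (isBirkhoff_counterterm h𝒢 g) h).1

theorem counterterm_mul_of_isRegular {g ψ : CharGroup H (LaurentSeries R)}
    (hψ : ∀ x, IsRegular (ψ x)) : counterterm h𝒢 (g * ψ) = counterterm h𝒢 g := by
  have h := isBirkhoff_counterterm h𝒢 g
  refine IsBirkhoff.counterterm_eq h𝒢 (p := counterterm h𝒢 g * g * ψ) ⟨by group, ?_, h.polar⟩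
  exact CharGroup.isRegular_mul h.regular hψ

end Laurent

/-! ### Families depending on the mass scale -/

section Families

/-- Evaluation of an entire function at `s = 0`. -/
def EntireFun.evalZero : EntireFun →ₐ[ℂ] ℂ :=
  (Pi.evalAlgHom ℂ (fun _ : ℂ => ℂ) 0).comp EntireFun.val

/-- Restriction of a family to `s = 0`, that is to `t = 1`. -/
noncomputable def atOne : LaurentF →ₐ[ℂ] LaurentA where
  toFun f := f.map EntireFun.evalZero
  map_one' := HahnSeries.map_one (EntireFun.evalZero : EntireFun →+* ℂ).toMonoidWithZeroHom
  map_mul' f g := HahnSeries.map_mul ((EntireFun.evalZero : EntireFun →+* ℂ) : EntireFun →ₙ+* ℂ)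
  map_zero' := by ext n; simp
  map_add' f g := by ext n; simp
  commutes' c := by
    rw [HahnSeries.algebraMap_apply, HahnSeries.algebraMap_apply]
    exact HahnSeries.map_C _ (EntireFun.evalZero : EntireFun →+* ℂ)

theorem atOne_coeff (f : LaurentF) (n : ℤ) : (atOne f).coeff n = (f.coeff n : ℂ → ℂ) 0 := rfl

theorem constFamily_coeff (f : LaurentA) (n : ℤ) :
    (constFamily f).coeff n = algebraMap ℂ EntireFun (f.coeff n) := rfl

theorem atOne_constFamily (f : LaurentA) : atOne (constFamily f) = f := rfl

theorem IsRegular.atOne {f : LaurentF} (hf : IsRegular f) : IsRegular (atOne f) := fun n hn => by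
  rw [atOne_coeff, hf n hn]; rfl

theorem IsPolar.atOne {f : LaurentF} (hf : IsPolar f) : IsPolar (atOne f) := fun n hn => by
  rw [atOne_coeff, hf n hn]; rfl

theorem IsRegular.constFamily {f : LaurentA} (hf : IsRegular f) : IsRegular (constFamily f) :=
  fun n hn => by rw [constFamily_coeff, hf n hn, map_zero]

theorem eq_constFamily_of_ds_eq_zero {f : LaurentF} (hf : ds f = 0) :
    f = constFamily (atOne f) := by
  ext n s
  have h : deriv (f.coeff n : ℂ → ℂ) = 0 :=
    congrArg Subtype.val (congrArg (fun g : LaurentF => g.coeff n) hf)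
  exact is_const_of_deriv_eq_zero (f.coeff n).2 (fun s => congrFun h s) s 0

/-- The derivative of a family at `t = 1`. -/
noncomputable def derivAtOne : LaurentF →ₗ[ℂ] LaurentA := atOne.toLinearMap ∘ₗ ds

theorem derivAtOne_mul (f g : LaurentF) :
    derivAtOne (f * g) = derivAtOne f * atOne g + atOne f * derivAtOne g := by
  change atOne (ds (f * g)) = _
  rw [ds_mul, map_add, map_mul, map_mul]
  rfl

theorem derivAtOne_constFamily (f : LaurentA) : derivAtOne (constFamily f) = 0 := by
  ext n
  exact deriv_const (0 : ℂ) (f.coeff n)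

theorem expSZ_coeff (n : ℕ) (s : ℂ) :
    (expSZ.coeff n : ℂ → ℂ) s = s ^ n / (n.factorial : ℂ) := by
  rw [expSZ, HahnSeries.ofPowerSeries_apply_coeff, PowerSeries.coeff_mk]

theorem isRegular_expSZ : IsRegular expSZ := fun n hn =>
  HahnSeries.embDomain_of_notMem_range
    (by rintro ⟨m, rfl⟩; exact absurd hn (not_lt.2 (Int.natCast_nonneg m)))

theorem atOne_expSZ : atOne expSZ = 1 := by
  ext n
  rw [atOne_coeff]
  rcases lt_or_ge n 0 with hn | hn
  · rw [isRegular_expSZ n hn, HahnSeries.coeff_one, if_neg hn.ne]; rfl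
  · lift n to ℕ using hn
    rw [expSZ_coeff, HahnSeries.coeff_one]
    rcases Nat.eq_zero_or_pos n with rfl | h
    · simp
    · rw [if_neg (by omega), zero_pow h.ne', zero_div]

theorem derivAtOne_expSZ : derivAtOne expSZ = HahnSeries.single 1 1 := by
  ext n
  change deriv (expSZ.coeff n : ℂ → ℂ) 0 = _
  rcases lt_or_ge n 0 with hn | hn
  · rw [isRegular_expSZ n hn, HahnSeries.coeff_single_of_ne (by omega)]
    exact deriv_const (0 : ℂ) (0 : ℂ)
  · lift n to ℕ using hn
    have : (expSZ.coeff n : ℂ → ℂ) = fun s => s ^ n / (n.factorial : ℂ) :=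
      funext (expSZ_coeff n)
    rw [this, deriv_div_const, deriv_pow_field]
    rcases n with _ | _ | n
    · simp
    · simp
    · rw [HahnSeries.coeff_single_of_ne (by omega)]
      simp

theorem derivAtOne_expSZ_pow (n : ℕ) :
    derivAtOne (expSZ ^ n) = (n : LaurentA) * HahnSeries.single (1 : ℤ) (1 : ℂ) := by
  induction n with
  | zero =>
    rw [pow_zero, Nat.cast_zero, zero_mul, ← map_one constFamily, derivAtOne_constFamily]
  | succ n ih =>
    rw [pow_succ, derivAtOne_mul, ih, derivAtOne_expSZ, map_pow, atOne_expSZ, one_pow, mul_one,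
      Nat.cast_succ, add_mul]

end Families

/-! ### Convergent families -/

section Convergence

theorem exists_coeff_eq_zero_of_lt {R : Type*} [Zero R] (f : HahnSeries ℤ R) :
    ∃ N : ℕ, ∀ n : ℤ, n < -N → f.coeff n = 0 :=
  ⟨f.order.natAbs, fun _ hn => HahnSeries.coeff_eq_zero_of_lt_order (by omega)⟩

/-- A geometric bound on a sequence with finitely many negative indices may be weakened to any larger
ratio. -/
theorem norm_le_mul_zpow_of_le {E : Type*} [SeminormedAddCommGroup E] {a : ℤ → E} {C ρ σ : ℝ}
    {N : ℕ} (hρ : 0 < ρ) (hσ : ρ ≤ σ) (hN : ∀ n : ℤ, n < -N → a n = 0)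
    (ha : ∀ n, ‖a n‖ ≤ C * ρ ^ n) (n : ℤ) : ‖a n‖ ≤ C * (σ / ρ) ^ N * σ ^ n := by
  have hσ0 : 0 < σ := hρ.trans_le hσ
  have hC : 0 ≤ C := nonneg_of_mul_nonneg_left ((norm_nonneg _).trans (ha 0)) (zpow_pos hρ 0)
  rcases lt_or_ge n (-N) with hn | hn
  · rw [hN n hn, norm_zero]
    positivity
  · refine (ha n).trans ?_
    rw [mul_assoc]
    refine mul_le_mul_of_nonneg_left ?_ hC
    obtain ⟨m, rfl⟩ : ∃ m : ℕ, n = m - N := ⟨(n + N).toNat, by omega⟩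
    rw [zpow_sub₀ hρ.ne', zpow_sub₀ hσ0.ne', div_pow, zpow_natCast, zpow_natCast, zpow_natCast,
      zpow_natCast]
    have h1 : ρ ^ m ≤ σ ^ m := pow_le_pow_left₀ hρ.le hσ m
    have h2 : σ ^ N / ρ ^ N * (σ ^ m / σ ^ N) = σ ^ m / ρ ^ N := by
      field_simp
    rw [h2]
    gcongr

theorem SeriesKind.MemFamily.add {k : SeriesKind} {f g : LaurentF} (hf : k.MemFamily f)
    (hg : k.MemFamily g) : k.MemFamily (f + g) := by
  cases k with
  | formal => trivial
  | convergent =>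
    intro r
    obtain ⟨C, ρ, hρ, h⟩ := hf r
    obtain ⟨C', ρ', hρ', h'⟩ := hg r
    obtain ⟨N, hN⟩ := exists_coeff_eq_zero_of_lt f
    obtain ⟨N', hN'⟩ := exists_coeff_eq_zero_of_lt g
    refine ⟨C * (max ρ ρ' / ρ) ^ N + C' * (max ρ ρ' / ρ') ^ N', max ρ ρ', lt_max_of_lt_left hρ,
      fun s hs n => ?_⟩
    rw [add_mul]
    refine (norm_add_le _ _).trans (add_le_add ?_ ?_)
    · exact norm_le_mul_zpow_of_le (a := fun n => (f.coeff n : ℂ → ℂ) s) hρ (le_max_left _ _)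
        (fun n hn => by rw [hN n hn]; rfl) (h s hs) n
    · exact norm_le_mul_zpow_of_le (a := fun n => (g.coeff n : ℂ → ℂ) s) hρ' (le_max_right _ _)
        (fun n hn => by rw [hN' n hn]; rfl) (h' s hs) n

theorem SeriesKind.MemFamily.mul {k : SeriesKind} {f g : LaurentF} (hf : k.MemFamily f)
    (hg : k.MemFamily g) : k.MemFamily (f * g) := by
  cases k with
  | formal => trivial
  | convergent =>
    intro r
    obtain ⟨C, ρ, hρ, h⟩ := hf r
    obtain ⟨C', ρ', hρ', h'⟩ := hg r
    obtain ⟨N, hN⟩ := exists_coeff_eq_zero_of_lt f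
    obtain ⟨N', hN'⟩ := exists_coeff_eq_zero_of_lt g
    -- bound both factors with the same ratio `σ`
    set σ := max ρ ρ' with hσ
    have hσ0 : 0 < σ := lt_max_of_lt_left hρ
    set D := C * (σ / ρ) ^ N with hD
    set D' := C' * (σ / ρ') ^ N' with hD'
    have hf' : ∀ s : ℂ, ‖s‖ ≤ r → ∀ n, ‖(f.coeff n : ℂ → ℂ) s‖ ≤ D * σ ^ n := fun s hs n =>
      norm_le_mul_zpow_of_le (a := fun n => (f.coeff n : ℂ → ℂ) s) hρ (le_max_left _ _)
        (fun n hn => by rw [hN n hn]; rfl) (h s hs) n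
    have hg' : ∀ s : ℂ, ‖s‖ ≤ r → ∀ n, ‖(g.coeff n : ℂ → ℂ) s‖ ≤ D' * σ ^ n := fun s hs n =>
      norm_le_mul_zpow_of_le (a := fun n => (g.coeff n : ℂ → ℂ) s) hρ' (le_max_right _ _)
        (fun n hn => by rw [hN' n hn]; rfl) (h' s hs) n
    -- the coefficient of `z ^ n` has at most `n + N + N' + 1 ≤ 2 ^ (n + N + N')` terms
    refine ⟨D * D' * 2 ^ (N + N'), 2 * σ, by positivity, fun s hs n => ?_⟩
    have hDD : 0 ≤ D * D' := by
      have h1 := (norm_nonneg _).trans (hf' s hs 0)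
      have h2 := (norm_nonneg _).trans (hg' s hs 0)
      rw [zpow_zero, mul_one] at h1 h2
      exact mul_nonneg h1 h2
    have key : ((f * g).coeff n : ℂ → ℂ) s =
        ∑ ij ∈ Finset.antidiagonal f.isPWO_support g.isPWO_support n,
          (f.coeff ij.1 : ℂ → ℂ) s * (g.coeff ij.2 : ℂ → ℂ) s := by
      rw [HahnSeries.coeff_mul]
      exact map_sum ((Pi.evalRingHom (fun _ : ℂ => ℂ) s).comp EntireFun.val.toRingHom) _ _
    set A := Finset.antidiagonal f.isPWO_support g.isPWO_support n
    have hmem : ∀ ij ∈ A, ij.1 ∈ Finset.Icc (-N : ℤ) (n + N') := by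
      intro ij hij
      obtain ⟨h1, h2, h3⟩ := Finset.mem_antidiagonal.1 hij
      have h4 : -(N : ℤ) ≤ ij.1 := not_lt.1 fun hlt => h1 (hN _ hlt)
      have h5 : -(N' : ℤ) ≤ ij.2 := not_lt.1 fun hlt => h2 (hN' _ hlt)
      exact Finset.mem_Icc.2 ⟨h4, by omega⟩
    have hcard : A.card ≤ (n + N' + 1 + N).toNat := by
      have := Finset.card_le_card_of_injOn (s := A) Prod.fst hmem (by
        intro x hx y hy hxy
        have hx' := (Finset.mem_antidiagonal.1 hx).2.2
        have hy' := (Finset.mem_antidiagonal.1 hy).2.2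
        exact Prod.ext hxy (by omega))
      rwa [Int.card_Icc, sub_neg_eq_add] at this
    have hsum : ‖((f * g).coeff n : ℂ → ℂ) s‖ ≤ A.card * (D * D' * σ ^ n) := by
      rw [key, ← nsmul_eq_mul]
      refine (norm_sum_le _ _).trans (Finset.sum_le_card_nsmul _ _ _ fun ij hij => ?_)
      have hn := (Finset.mem_antidiagonal.1 hij).2.2
      rw [norm_mul, ← hn, zpow_add₀ hσ0.ne']
      calc _ ≤ (D * σ ^ ij.1) * (D' * σ ^ ij.2) :=
            mul_le_mul (hf' s hs _) (hg' s hs _) (norm_nonneg _)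
              ((norm_nonneg _).trans (hf' s hs _))
        _ = _ := by ring
    refine hsum.trans ?_
    have hc : (A.card : ℝ) ≤ 2 ^ (N + N') * 2 ^ n := by
      rcases Nat.eq_zero_or_pos A.card with h0 | h0
      · rw [h0, Nat.cast_zero]; positivity
      · obtain ⟨m, hm⟩ : ∃ m : ℕ, n = m - (N + N' : ℕ) := ⟨(n + N + N').toNat, by omega⟩
        have h1 : A.card ≤ 2 ^ m := by
          have := Nat.lt_two_pow_self (n := m)
          omega
        have h2 : (2 : ℝ) ^ (N + N') * 2 ^ n = 2 ^ m := by
          rw [hm, zpow_sub₀ two_ne_zero, zpow_natCast, zpow_natCast]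
          field_simp
        rw [h2]
        exact_mod_cast h1
    calc (A.card : ℝ) * (D * D' * σ ^ n) ≤ 2 ^ (N + N') * 2 ^ n * (D * D' * σ ^ n) := by gcongr
      _ = _ := by rw [mul_zpow]; ring

theorem SeriesKind.memFamily_zero (k : SeriesKind) : k.MemFamily 0 := by
  cases k with
  | formal => trivial
  | convergent =>
    refine fun r => ⟨0, 1, one_pos, fun s _ n => ?_⟩
    rw [zero_mul]
    exact norm_zero.le

theorem SeriesKind.memFamily_one (k : SeriesKind) : k.MemFamily 1 := by
  cases k with
  | formal => trivial
  | convergent =>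
    refine fun r => ⟨1, 1, one_pos, fun s _ n => ?_⟩
    rw [one_zpow, mul_one, HahnSeries.coeff_one]
    split_ifs
    · exact norm_one.le
    · exact norm_zero.trans_le zero_le_one

/-- The ring of families over `Δ* × {t}`, in either reading. -/
def SeriesKind.family (k : SeriesKind) : Subsemiring LaurentF where
  carrier := {f | k.MemFamily f}
  zero_mem' := k.memFamily_zero
  one_mem' := k.memFamily_one
  add_mem' := .add
  mul_mem' := .mul

theorem SeriesKind.Mem.constFamily {k : SeriesKind} {f : LaurentA} (hf : k.Mem f) :
    k.MemFamily (constFamily f) := by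
  cases k with
  | formal => trivial
  | convergent =>
    obtain ⟨C, ρ, hρ, h⟩ := hf
    exact fun r => ⟨C, ρ, hρ, fun s _ n => h n⟩

theorem SeriesKind.memFamily_expSZ (k : SeriesKind) : k.MemFamily expSZ := by
  cases k with
  | formal => trivial
  | convergent =>
    refine fun r => ⟨1, max r 1, by positivity, fun s hs n => ?_⟩
    rcases lt_or_ge n 0 with hn | hn
    · rw [isRegular_expSZ n hn]
      exact norm_zero.trans_le (by positivity)
    · lift n to ℕ using hn
      rw [expSZ_coeff, one_mul, zpow_natCast, norm_div, norm_pow, Complex.norm_natCast]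
      refine (div_le_self (by positivity) (by exact_mod_cast n.factorial_pos)).trans ?_
      exact pow_le_pow_left₀ (norm_nonneg _) (hs.trans (le_max_left _ _)) n

end Convergence

/-! ### The running section -/

section Running

variable {H : Type*} [CommRing H] [HopfAlgebra ℂ H] {𝒢 : ℕ → Submodule ℂ H} [GradedAlgebra 𝒢]

theorem constSection_mul (γ γ' : CharGroup H LaurentA) :
    constSection (γ * γ') = constSection γ * constSection γ' :=
  map_mul (CharGroup.mapHom (H := H) (K := LaurentA) (L := LaurentF) constFamily) γ γ'

theorem constSection_inv (γ : CharGroup H LaurentA) :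
    constSection γ⁻¹ = (constSection γ)⁻¹ := 
  map_inv (CharGroup.mapHom (H := H) (K := LaurentA) (L := LaurentF) constFamily) γ

theorem runningSection_mul (h𝒢 : IsConnectedGradedHopf 𝒢) (γ γ' : CharGroup H LaurentA) :
    runningSection 𝒢 (γ * γ') = runningSection 𝒢 γ * runningSection 𝒢 γ' := by
  rw [runningSection, constSection_mul, scale_mul h𝒢]; rfl

theorem runningSection_apply (γ : CharGroup H LaurentA) {n : ℕ} {x : H} (hx : x ∈ 𝒢 n) :
    runningSection 𝒢 γ x = expSZ ^ n * constFamily (γ x) :=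
  scale_apply 𝒢 expSZ _ n x hx

/-- The values of the running section lie in every ring of families that contains `t ^ z` and the
values of the character. -/
theorem runningSection_mem (S : Subsemiring LaurentF) (hS : expSZ ∈ S) {γ : CharGroup H LaurentA}
    (hγ : ∀ x, constFamily (γ x) ∈ S) (x : H) : runningSection 𝒢 γ x ∈ S := by
  refine DirectSum.Decomposition.inductionOn 𝒢
    (motive := fun x => (runningSection 𝒢 γ).ofConv x ∈ S) ?_ ?_ ?_ x
  · rw [map_zero]
    exact S.zero_mem
  · intro n y
    change runningSection 𝒢 γ y ∈ S
    rw [runningSection_apply γ y.2]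
    exact S.mul_mem (S.pow_mem hS n) (hγ _)
  · intro y z hy hz
    rw [map_add]
    exact S.add_mem hy hz

theorem isRegular_runningSection {γ : CharGroup H LaurentA} (hγ : ∀ x, IsRegular (γ x)) (x : H) :
    IsRegular (runningSection 𝒢 γ x) :=
  runningSection_mem (𝒢 := 𝒢)
    { regularSeries EntireFun with
      mul_mem' := IsRegular.mul
      one_mem' := by
        have := isRegular_smul_one (R := EntireFun) 1
        rwa [map_one] at this }
    isRegular_expSZ (fun x => (hγ x).constFamily) x

theorem memFamily_runningSection {k : SeriesKind} {γ : CharGroup H LaurentA} (hγ : γ ∈ charsA H k)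
    (x : H) : k.MemFamily (runningSection 𝒢 γ x) :=
  runningSection_mem k.family k.memFamily_expSZ (fun x => (hγ x).constFamily) x

theorem atOne_runningSection (γ : CharGroup H LaurentA) :
    CharGroup.mapHom atOne (runningSection 𝒢 γ) = γ := by
  refine CharGroup.ext_homogeneous (𝒢 := 𝒢) fun n x hx => ?_
  rw [CharGroup.mapHom_apply, runningSection_apply γ hx, map_mul, map_pow, atOne_expSZ, one_pow,
    one_mul, atOne_constFamily]

theorem derivAtOne_runningSection (γ : CharGroup H LaurentA) :
    LinForm.post derivAtOne (runningSection 𝒢 γ).toLin =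
      LinForm.scalarMul (HahnSeries.single 1 1) (gradeOp 𝒢 γ.toLin) := by
  refine LinForm.ext_homogeneous (𝒢 := 𝒢) fun n x hx => ?_
  rw [LinForm.post_apply, LinForm.scalarMul_apply, gradeOp_apply _ hx, toLin_apply, toLin_apply,
    runningSection_apply γ hx, derivAtOne_mul, derivAtOne_constFamily, mul_zero, add_zero,
    derivAtOne_expSZ_pow, atOne_constFamily, Algebra.smul_def, map_natCast]
  ring

theorem atOne_renormFlow (γ : CharGroup H LaurentA) :
    CharGroup.mapHom atOne (renormFlow 𝒢 γ) = 1 := by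
  rw [renormFlow, map_mul, map_inv, atOne_runningSection]
  exact inv_mul_cancel γ

/-- The flow `g⁻¹ ⋆ t^{zY} g` has derivative `z R̃(g)` at `t = 1`. -/
theorem derivAtOne_renormFlow (γ : CharGroup H LaurentA) (x : H) :
    derivAtOne (renormFlow 𝒢 γ x) = HahnSeries.single 1 1 * rTilde 𝒢 γ x := by
  have h1 : LinForm.post derivAtOne (constSection γ)⁻¹.toLin = 0 :=
    LinForm.ext_apply fun x => derivAtOne_constFamily _
  have h2 : LinForm.post atOne.toLinearMap (constSection γ)⁻¹.toLin = γ⁻¹.toLin := rfl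
  have h := LinForm.post_mul_of_leibniz derivAtOne_mul (constSection γ)⁻¹.toLin
    (runningSection 𝒢 γ).toLin
  rw [h1, zero_mul, zero_add, derivAtOne_runningSection, h2, LinForm.mul_scalarMul] at h
  exact congrArg (fun a : LinForm H LaurentA => a x) h

theorem beta_apply (γ : CharGroup H LaurentA) (x : H) :
    beta 𝒢 γ x = (derivAtOne (renormFlow 𝒢 γ x)).coeff 0 := rfl

theorem beta_apply_eq_coeff_rTilde (γ : CharGroup H LaurentA) (x : H) :
    beta 𝒢 γ x = (rTilde 𝒢 γ x).coeff (-1) := by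
  rw [beta_apply, derivAtOne_renormFlow, coeff_single_one_mul]
  rfl

theorem isInfinitesimal_beta (γ : CharGroup H LaurentA) : IsInfinitesimal (beta 𝒢 γ) := by
  intro x y
  have h1 : ∀ x, atOne (renormFlow 𝒢 γ x) = algebraMap ℂ LaurentA (Coalgebra.counit x) :=
    fun x => congrArg (fun g : CharGroup H LaurentA => g x) (atOne_renormFlow γ)
  have h2 : renormFlow 𝒢 γ (x * y) = renormFlow 𝒢 γ x * renormFlow 𝒢 γ y :=
    map_mul (renormFlow 𝒢 γ).ofConv x y
  rw [beta_apply, h2, derivAtOne_mul, h1, h1, mul_comm (derivAtOne _), ← Algebra.smul_def,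
    ← Algebra.smul_def, HahnSeries.coeff_add, HahnSeries.coeff_smul, HahnSeries.coeff_smul,
    ← beta_apply, ← beta_apply, add_comm, mul_comm (beta 𝒢 γ x), smul_eq_mul, smul_eq_mul]
  exact add_comm _ _

/-- If the limit defining `β(g)` exists, then `R̃(g)` has at most a simple pole. -/
theorem HasBeta.isRegular_mul_rTilde {γ : CharGroup H LaurentA} (h : HasBeta 𝒢 γ) (x : H) :
    IsRegular (HahnSeries.single 1 1 * rTilde 𝒢 γ x) := by
  rw [← derivAtOne_renormFlow]
  intro n hn
  change EntireFun.evalZero (EntireFun.deriv ((renormFlow 𝒢 γ x).coeff n)) = 0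
  rw [h x n hn, map_zero, map_zero]

/-- For a character `g` that is polar on the augmentation ideal, `R̃(g) = β(g) / z`. -/
theorem HasBeta.rTilde_apply_eq (h𝒢 : IsConnectedGradedHopf 𝒢) {γ : CharGroup H LaurentA}
    (h : HasBeta 𝒢 γ) (hγ : ∀ x, Coalgebra.counit (R := ℂ) x = 0 → IsPolar (γ x)) (x : H) :
    rTilde 𝒢 γ x = HahnSeries.single (-1) (beta 𝒢 γ x) := by
  ext n
  rcases lt_trichotomy n (-1) with hn | rfl | hn
  · have := h.isRegular_mul_rTilde x (n + 1) (by omega)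
    rw [coeff_single_one_mul, add_sub_cancel_right] at this
    rw [this, HahnSeries.coeff_single_of_ne hn.ne]
  · rw [HahnSeries.coeff_single_same, beta_apply_eq_coeff_rTilde]
  · rw [HahnSeries.coeff_single_of_ne hn.ne', isPolar_rTilde h𝒢 hγ x n (by omega)]

/-- The cocycle property of `R̃` gives that of `β`: multiplication on the right by a regular
character conjugates `β` by its value at `z = 0`. -/
theorem HasBeta.beta_mul (h𝒢 : IsConnectedGradedHopf 𝒢) {u p : CharGroup H LaurentA}
    (hu : HasBeta 𝒢 u) (hp : ∀ x, IsRegular (p x)) :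
    beta 𝒢 (u * p) = valueAtZero p⁻¹ * beta 𝒢 u * valueAtZero p := by
  let c : LaurentA →ₗ[ℂ] ℂ := HahnSeries.coeff.linearMap (R := ℂ) 0
  let z : LaurentA := HahnSeries.single 1 1
  have hc : ∀ {a b : LinForm H LaurentA}, (∀ x, IsRegular (a x)) → (∀ x, IsRegular (b x)) →
      LinForm.post c (a * b) = LinForm.post c a * LinForm.post c b := by
    intro a b ha hb
    refine LinForm.ext_apply fun x => ?_
    let r := Coalgebra.Repr.arbitrary ℂ x
    change c ((a * b) x) = (LinForm.post c a * LinForm.post c b) x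
    rw [r.convMul_apply, r.convMul_apply, map_sum]
    exact Finset.sum_congr rfl fun i _ => (ha _).coeff_zero_mul (hb _)
  have hβ : ∀ g : CharGroup H LaurentA,
      beta 𝒢 g = LinForm.post c (LinForm.scalarMul z (rTilde 𝒢 g)) := by
    intro g
    refine LinForm.ext_apply fun x => ?_
    rw [beta_apply, derivAtOne_renormFlow]
    rfl
  have hp' : ∀ x, IsRegular (p⁻¹ x) := CharGroup.isRegular_inv hp
  -- `R̃(p)` is regular, hence has no residue
  have h0 : beta 𝒢 p = 0 := by
    refine LinForm.ext_apply fun x => ?_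
    rw [beta_apply_eq_coeff_rTilde]
    exact LinForm.isRegular_mul (a := p⁻¹.toLin) hp' (fun y => hp (degreeOp 𝒢 y)) x (-1) (by omega)
  have hu' : ∀ x, IsRegular (LinForm.scalarMul z (rTilde 𝒢 u) x) := hu.isRegular_mul_rTilde
  rw [hβ, rTilde_mul h𝒢, LinForm.scalarMul_add, LinForm.post_add, ← hβ p, h0, add_zero,
    LinForm.scalarMul_mul, ← LinForm.mul_scalarMul,
    hc (b := p.toLin) (LinForm.isRegular_mul (a := p⁻¹.toLin) hp' hu') hp,
    hc (a := p⁻¹.toLin) hp' hu', ← hβ u]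
  rfl

end Running

/-! ### Local characters -/

section Local

variable {H : Type*} [CommRing H] [HopfAlgebra ℂ H] {𝒢 : ℕ → Submodule ℂ H} [GradedAlgebra 𝒢]
  {h𝒢 : IsConnectedGradedHopf 𝒢} {γ γ' : CharGroup H LaurentA}

/-- For a local character the counterterm of the running section is that of the character itself,
by uniqueness of the Birkhoff decomposition at `t = 1`. -/
theorem IsLocal.counterterm_runningSection (h : IsLocal h𝒢 γ) :
    counterterm h𝒢 (runningSection 𝒢 γ) = constSection (counterterm h𝒢 γ) := by
  set M := counterterm h𝒢 (runningSection 𝒢 γ) with hM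
  have hB := isBirkhoff_counterterm h𝒢 (runningSection 𝒢 γ)
  rw [← hM] at hB
  have hB1 : IsBirkhoff γ (CharGroup.mapHom atOne M)
      (CharGroup.mapHom atOne (M * runningSection 𝒢 γ)) := by
    refine ⟨?_, fun x => (hB.regular x).atOne, fun x hx => (hB.polar x hx).atOne⟩
    rw [map_mul, inv_mul_cancel_left, atOne_runningSection]
  rw [hB1.counterterm_eq h𝒢]
  exact CharGroup.ext_apply fun x => eq_constFamily_of_ds_eq_zero (h x)

theorem IsLocal.isRegular (h : IsLocal h𝒢 γ) (x : H) :
    IsRegular ((constSection (counterterm h𝒢 γ) * runningSection 𝒢 γ) x) := by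
  rw [← h.counterterm_runningSection]
  exact (isBirkhoff_counterterm h𝒢 _).regular x

theorem IsLocal.hasBeta_counterterm_inv (h : IsLocal h𝒢 γ) :
    HasBeta 𝒢 (counterterm h𝒢 γ)⁻¹ := by
  set m := counterterm h𝒢 γ with hm
  have e : runningSection 𝒢 m⁻¹ * runningSection 𝒢 (m * γ) = runningSection 𝒢 γ := by
    rw [← runningSection_mul h𝒢, inv_mul_cancel_left]
  have e' : renormFlow 𝒢 m⁻¹ =
      constSection m * runningSection 𝒢 γ * (runningSection 𝒢 (m * γ))⁻¹ := by
    rw [renormFlow, constSection_inv, inv_inv, ← e]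
    group
  intro x
  rw [e']
  exact CharGroup.isRegular_mul h.isRegular (CharGroup.isRegular_inv
    (isRegular_runningSection (isBirkhoff_counterterm h𝒢 γ).regular)) x

theorem IsLocal.hasBeta (h : IsLocal h𝒢 γ) : HasBeta 𝒢 γ := by
  set m := counterterm h𝒢 γ with hm
  have e : renormFlow 𝒢 γ =
      (constSection (m * γ))⁻¹ * (constSection m * runningSection 𝒢 γ) := by
    rw [renormFlow, constSection_mul]
    group
  intro x
  rw [e]
  refine CharGroup.isRegular_mul (CharGroup.isRegular_inv fun y => ?_) h.isRegular x
  exact ((isBirkhoff_counterterm h𝒢 γ).regular y).constFamily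

theorem IsLocal.beta_eq (h : IsLocal h𝒢 γ) :
    beta 𝒢 γ = valueAtZero (counterterm h𝒢 γ * γ)⁻¹ * beta 𝒢 (counterterm h𝒢 γ)⁻¹ *
      valueAtZero (counterterm h𝒢 γ * γ) := by
  rw [← h.hasBeta_counterterm_inv.beta_mul h𝒢 (isBirkhoff_counterterm h𝒢 γ).regular,
    inv_mul_cancel_left]

theorem constSection_injective :
    Function.Injective (constSection : CharGroup H LaurentA → CharGroup H LaurentF) :=
  fun _ _ h => CharGroup.ext_apply fun x =>
    congrArg (fun g : CharGroup H LaurentF => atOne (g x)) h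

theorem IsLocal.rTilde_counterterm_eq_iff (h : IsLocal h𝒢 γ) (h' : IsLocal h𝒢 γ') :
    rTilde 𝒢 (counterterm h𝒢 (runningSection 𝒢 γ)) =
      rTilde 𝒢 (counterterm h𝒢 (runningSection 𝒢 γ')) ↔
    counterterm h𝒢 γ = counterterm h𝒢 γ' := by
  rw [(rTilde_injective h𝒢).eq_iff, h.counterterm_runningSection, h'.counterterm_runningSection,
    constSection_injective.eq_iff]

theorem IsLocal.beta_counterterm_inv_eq_iff (h : IsLocal h𝒢 γ) (h' : IsLocal h𝒢 γ') :
    beta 𝒢 (counterterm h𝒢 γ)⁻¹ = beta 𝒢 (counterterm h𝒢 γ')⁻¹ ↔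
    counterterm h𝒢 γ = counterterm h𝒢 γ' := by
  refine ⟨fun e => inv_injective (rTilde_injective h𝒢 (LinForm.ext_apply fun x => ?_)),
    fun e => by rw [e]⟩
  have hpol : ∀ {γ : CharGroup H LaurentA} (x : H), Coalgebra.counit (R := ℂ) x = 0 →
      IsPolar ((counterterm h𝒢 γ)⁻¹ x) := fun x hx =>
    (isBirkhoff_counterterm h𝒢 _).polar _ ((HopfAlgebra.counit_antipode x).trans hx)
  rw [h.hasBeta_counterterm_inv.rTilde_apply_eq h𝒢 hpol,
    h'.hasBeta_counterterm_inv.rTilde_apply_eq h𝒢 hpol, e]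

theorem IsLocal.exists_gauge_iff {k : SeriesKind} (hγ : γ ∈ charsA H k) (hγ' : γ' ∈ charsA H k)
    (h : IsLocal h𝒢 γ) (h' : IsLocal h𝒢 γ') :
    (∃ ψ ∈ gaugeGroup H k, runningSection 𝒢 γ' = runningSection 𝒢 γ * ψ) ↔
    counterterm h𝒢 γ = counterterm h𝒢 γ' := by
  constructor
  · rintro ⟨ψ, hψ, e⟩
    refine constSection_injective ?_
    rw [← h.counterterm_runningSection, ← h'.counterterm_runningSection, e,
      counterterm_mul_of_isRegular h𝒢 fun x => (hψ x).1]
  · intro e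
    refine ⟨(runningSection 𝒢 γ)⁻¹ * runningSection 𝒢 γ', fun x => ⟨?_, ?_⟩,
      (mul_inv_cancel_left _ _).symm⟩
    · have e' : (runningSection 𝒢 γ)⁻¹ * runningSection 𝒢 γ' =
          (constSection (counterterm h𝒢 γ) * runningSection 𝒢 γ)⁻¹ *
            (constSection (counterterm h𝒢 γ') * runningSection 𝒢 γ') := by
        rw [e]
        group
      rw [e']
      exact CharGroup.isRegular_mul (CharGroup.isRegular_inv h.isRegular) h'.isRegular x
    · exact LinForm.mul_mem k.family.toAddSubmonoid (a := (runningSection 𝒢 γ)⁻¹.toLin)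
        (b := (runningSection 𝒢 γ').toLin) (fun y z => SeriesKind.MemFamily.mul
        (memFamily_runningSection hγ (HopfAlgebra.antipode ℂ y))
        (memFamily_runningSection hγ' z)) x

end Local

end Renormalization

theorem mainTheorem2 {H : Type*} [CommRing H] [HopfAlgebra ℂ H]
    (𝒢 : ℕ → Submodule ℂ H) [GradedAlgebra 𝒢] (h𝒢 : IsConnectedGradedHopf 𝒢)
    (k : SeriesKind) (ω : Connection H)
    (hω : ∀ γ ∈ charsA H k, ω.pullback (runningSection 𝒢 γ) = logD (runningSection 𝒢 γ)) :
    -- the β-function of a local section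
    (∀ γ ∈ charsA H k, IsLocal h𝒢 γ →
      HasBeta 𝒢 (counterterm h𝒢 γ)⁻¹ ∧
      IsInfinitesimal (beta 𝒢 (counterterm h𝒢 γ)⁻¹) ∧
      HasBeta 𝒢 γ ∧
      beta 𝒢 γ = valueAtZero (counterterm h𝒢 γ * γ)⁻¹ * beta 𝒢 (counterterm h𝒢 γ)⁻¹ *
        valueAtZero (counterterm h𝒢 γ * γ)) ∧
    -- the gauge class of the pullback is a function of `R̃(γ_{t^z -})` and of the β-function
    (∀ γ ∈ charsA H k, ∀ γ' ∈ charsA H k, IsLocal h𝒢 γ → IsLocal h𝒢 γ' →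
      (rTilde 𝒢 (counterterm h𝒢 (runningSection 𝒢 γ)) =
          rTilde 𝒢 (counterterm h𝒢 (runningSection 𝒢 γ')) →
        GaugeEquiv k (ω.pullback (runningSection 𝒢 γ)) (ω.pullback (runningSection 𝒢 γ'))) ∧
      (beta 𝒢 (counterterm h𝒢 γ)⁻¹ = beta 𝒢 (counterterm h𝒢 γ')⁻¹ →
        GaugeEquiv k (ω.pullback (runningSection 𝒢 γ)) (ω.pullback (runningSection 𝒢 γ'))) ∧
      (rTilde 𝒢 (counterterm h𝒢 (runningSection 𝒢 γ)) =
          rTilde 𝒢 (counterterm h𝒢 (runningSection 𝒢 γ')) ↔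
        beta 𝒢 (counterterm h𝒢 γ)⁻¹ = beta 𝒢 (counterterm h𝒢 γ')⁻¹) ∧
      (rTilde 𝒢 (counterterm h𝒢 (runningSection 𝒢 γ)) =
          rTilde 𝒢 (counterterm h𝒢 (runningSection 𝒢 γ')) ↔
        ∃ ψ ∈ gaugeGroup H k, runningSection 𝒢 γ' = runningSection 𝒢 γ * ψ)) := by
  have gauge : ∀ {γ γ' : CharGroup H LaurentA},
      (∃ ψ ∈ gaugeGroup H k, runningSection 𝒢 γ' = runningSection 𝒢 γ * ψ) →
      GaugeEquiv k (ω.pullback (runningSection 𝒢 γ)) (ω.pullback (runningSection 𝒢 γ')) := by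
    rintro γ γ' ⟨ψ, hψ, e⟩
    exact ⟨ψ, hψ, by rw [e, ω.pullback_mul]⟩
  refine ⟨fun γ _ h => ⟨h.hasBeta_counterterm_inv, isInfinitesimal_beta _, h.hasBeta, h.beta_eq⟩,
    fun γ hγ γ' hγ' h h' => ?_⟩
  have hR := h.rTilde_counterterm_eq_iff h'
  have hβ := h.beta_counterterm_inv_eq_iff h'
  have hψ := h.exists_gauge_iff hγ hγ' h'
  exact ⟨fun e => gauge (hψ.2 (hR.1 e)), fun e => gauge (hψ.2 (hβ.1 e)), hR.trans hβ.symm,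
    hR.trans hψ.symm⟩
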